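/- **Setting.** For a map $F:X\times X\to X\times X$ write $F=(F^1,F^2)$; call $F$ nondegenerate if it is bijective, for all $x,z$ there is a unique $y$ with $F^1(x,y)=z$, and for all $y,t$ there is a unique $x$ with $F^2(x,y)=t$. A *biquandle* $(X,S)$ is a set $X$ with a nondegenerate $S$ satisfying $(1\times S)(S\times 1)(1\times S)=(S\times 1)(1\times S)(S\times 1)$ and such that $\{(x,y):S(x,y)=(x,y)\}$ is the graph of a bijection $s:X\to X$. A *singular pair* $(X,S,\tau)$ is a biquandle $(X,S)$ with a nondegenerate $\tau$ such that $$\tau S=S\tau,\quad (S\times1)(1\times S)(\tau\times1)=(1\times\tau)(S\times1)(1\times S),\quad (1\times S)(S\times1)(1\times\tau)=(\tau\times1)(1\times S)(S\times1).$$ For a group $H$, maps $f,h:X\times X\to H$ form a *non-commutative 2-cocycle pair* if for all $x,y,z\in X$: - (f1) $f(x,y)f(S^2(x,y),z)=f(x,S^1(y,z))f(S^2(x,S^1(y,z)),S^2(y,z))$; - (f2) $f(S^1(x,y),S^1(S^2(x,y),z))=f(y,z)$; - (f3) $f(x,s(x))=1$; - (f4) $f(x,y)f(S^2(x,y),z)=f(x,\tau^1(y,z))f(S^2(x,\tau^1(y,z)),\tau^2(y,z))$;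 - (h1) $h(S^1(x,y),S^1(S^2(x,y),z))=h(y,z)$; - (c1) $f(x,S^1(y,z))h(S^2(x,S^1(y,z)),S^2(y,z))=h(x,y)f(\tau^2(x,y),z)$; - (c2) $f(y,z)h(S^2(x,S^1(y,z)),S^2(y,z))=h(x,y)f(\tau^1(x,y),S^1(\tau^2(x,y),z))$; - (c3) $h(x,y)=f(x,y)h(S(x,y))$; - (c4) $h(S(x,y))=h(x,y)f(\tau(x,y))$. Let $D$ be an oriented singular link diagram, with finitely many crossings, each positive, negative or singular. Draw every crossing with both strands going down. A *coloring* of $D$ assigns an element of $X$ to every semi-arc so that, if $p=(\text{upper left},\text{upper right})$ and $q=(\text{lower left},\text{lower right})$ are the colors at a crossing, then $S(p)=q$ at a positive, $S(q)=p$ at a negative, and $\tau(p)=q$ at a singular crossing. Its *Boltzmann weight* is $f(p)$, $f(q)^{-1}$, $h(p)$ respectively. Given a base point on a component of $D$, travel once along the component following the orientation and multiply, in the order in which they are met, the weights of the classical crossings passed along the under-strand and of all singular crossings passed (so a singular self-crossing of the component contributes twice). **Theorem.** Let $(X,S,\tau)$ be a singular pair and $(f,h)$ a non-commutative 2-cocycle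 pair with values in a group $H$. Let the oriented singular link diagram $D'$ be obtained from $D$ by one oriented Reidemeister move inside a disc, namely a classical move (RI, RII, RIII), the move RIV of a strand over or under a singular crossing, or the move RV carrying a classical crossing of the two strands of a singular crossing from one side of it to the other; all orientations of the strands, all signs, and both directions of the move are allowed. Then: 1. for each coloring $\mathcal C$ of $D$ there is exactly one coloring $\Phi(\mathcal C)$ of $D'$ that agrees with $\mathcal C$ outside the disc, and $\mathcal C\mapsto\Phi(\mathcal C)$ is a bijection from the colorings of $D$ onto those of $D'$; 2. there is a bijection between the components of $D$ and those of $D'$ that matches components having the same part outside the disc, and for each coloring $\mathcal C$ of $D$ and any two matching components, with arbitrary base points, the product of weights along the one for $\mathcal C$ and the product along the other for $\Phi(\mathcal C)$ are conjugate in $H$. Only the combinatorial incidence structure of crossings and semi-arcs matters; planarity of the diagrams is not needed. -/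

import Mathlib

/-! ## Biquandles, singular pairs and non-commutative cocycle pairs -/

section Algebra

/-- `F × 1` on `X × X × X`. -/
def actLeft {X : Type*} (F : X × X → X × X) : X × X × X → X × X × X :=
  fun v => ((F (v.1, v.2.1)).1, (F (v.1, v.2.1)).2, v.2.2)

/-- `1 × F` on `X × X × X`. -/
def actRight {X : Type*} (F : X × X → X × X) : X × X × X → X × X × X :=
  fun v => (v.1, F v.2)

/-- A bijective map `X × X → X × X` which is left and right invertible. -/
structure IsNondegenerate {X : Type*} (F : X × X → X × X) : Prop where
  bijective : Function.Bijective F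
  left_invertible : ∀ x z, ∃! y, (F (x, y)).1 = z
  right_invertible : ∀ y t, ∃! x, (F (x, y)).2 = t

/-- `(X, S)` is a biquandle: a non-degenerate set-theoretical solution of the Yang-Baxter equation
whose fixed points form the graph of a bijection `s : X → X`. -/
structure IsBiquandle {X : Type*} (S : X × X → X × X) : Prop extends IsNondegenerate S where
  yang_baxter :
    actRight S ∘ actLeft S ∘ actRight S = actLeft S ∘ actRight S ∘ actLeft S
  diagonal : ∃ s : X ≃ X, ∀ x y, S (x, y) = (x, y) ↔ y = s x

/-- `(X, S, τ)` is a singular pair. -/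
structure IsSingularPair {X : Type*} (S τ : X × X → X × X) : Prop where
  biquandle : IsBiquandle S
  nondegenerate : IsNondegenerate τ
  comm : τ ∘ S = S ∘ τ
  slide_over :
    actLeft S ∘ actRight S ∘ actLeft τ = actRight τ ∘ actLeft S ∘ actRight S
  slide_under :
    actRight S ∘ actLeft S ∘ actRight τ = actLeft τ ∘ actRight S ∘ actLeft S

/-- `(f, h)` is a non-commutative 2-cocycle pair for `(X, S, τ)` with values in `H`. In condition
`f3` the pairs `(x, y)` fixed by `S` are exactly the pairs `(x, s x)`. -/
structure IsNonCommCocyclePair {X H : Type*} [Group H] (S τ : X × X → X × X)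
    (f h : X × X → H) : Prop where
  f1 : ∀ x y z, f (x, y) * f ((S (x, y)).2, z) =
    f (x, (S (y, z)).1) * f ((S (x, (S (y, z)).1)).2, (S (y, z)).2)
  f2 : ∀ x y z, f ((S (x, y)).1, (S ((S (x, y)).2, z)).1) = f (y, z)
  f3 : ∀ x y, S (x, y) = (x, y) → f (x, y) = 1
  f4 : ∀ x y z, f (x, y) * f ((S (x, y)).2, z) =
    f (x, (τ (y, z)).1) * f ((S (x, (τ (y, z)).1)).2, (τ (y, z)).2)
  h1 : ∀ x y z, h ((S (x, y)).1, (S ((S (x, y)).2, z)).1) = h (y, z)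
  c1 : ∀ x y z, f (x, (S (y, z)).1) * h ((S (x, (S (y, z)).1)).2, (S (y, z)).2) =
    h (x, y) * f ((τ (x, y)).2, z)
  c2 : ∀ x y z, f (y, z) * h ((S (x, (S (y, z)).1)).2, (S (y, z)).2) =
    h (x, y) * f ((τ (x, y)).1, (S ((τ (x, y)).2, z)).1)
  c3 : ∀ x y, h (x, y) = f (x, y) * h (S (x, y))
  c4 : ∀ x y, h (S (x, y)) = h (x, y) * f (τ (x, y))

end Algebra

/-! ## Oriented singular link diagrams and tangles -/

/-- Positive classical, negative classical, or singular crossing. -/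
inductive CrossingKind where
  | pos | neg | sing
  deriving DecidableEq

/-- A crossing is drawn with both of its strands oriented downwards. The strand `ltr` enters at the
top left and leaves at the bottom right; the strand `rtl` enters at the top right and leaves at the
bottom left. At a positive crossing `ltr` is the under-strand, at a negative one `rtl` is. -/
inductive Strand where
  | ltr | rtl
  deriving DecidableEq

/-- An oriented singular tangle diagram, with incoming boundary points `I` and outgoing boundary
points `O`, recorded by its crossings, its semi-arcs, and the incidences between them: `enter (c, s)`
(resp. `leave (c, s)`) is the semi-arc through which the strand `s` of the crossing `c` arrives at
(resp. departs from) `c`; `source i` is the semi-arc that starts at the boundary point `i`, and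
`target o` the one that ends at the boundary point `o`.  Each semi-arc either has exactly one
starting point and exactly one end point, or is a circle without crossings.  A diagram drawn in the
plane gives such data; planarity is not imposed, so that everything below applies to all planar
diagrams and to all planar moves in particular. -/
structure Tangle (I O : Type) where
  Crossing : Type
  Arc : Type
  finite_crossing : Finite Crossing
  finite_arc : Finite Arc
  kind : Crossing → CrossingKind
  enter : Crossing × Strand → Arc
  leave : Crossing × Strand → Arc
  source : I → Arc
  target : O → Arc
  end_injective : Function.Injective (Sum.elim enter target)
  start_injective : Function.Injective (Sum.elim leave source)
  range_eq : Set.range (Sum.elim enter target) = Set.range (Sum.elim leave source)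

/-- An oriented singular link diagram: a tangle diagram without boundary points. -/
abbrev LinkDiagram := Tangle Empty Empty

/-! ## Colorings and Boltzmann weights -/

section Colorings

variable {X H : Type*} {I O : Type}

/-- The colors of the (left, right) incoming semi-arcs at a crossing. -/
def Tangle.colorsIn (D : Tangle I O) (C : D.Arc → X) (c : D.Crossing) : X × X :=
  (C (D.enter (c, Strand.ltr)), C (D.enter (c, Strand.rtl)))

/-- The colors of the (left, right) outgoing semi-arcs at a crossing. -/
def Tangle.colorsOut (D : Tangle I O) (C : D.Arc → X) (c : D.Crossing) : X × X :=
  (C (D.leave (c, Strand.rtl)), C (D.leave (c, Strand.ltr)))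

/-- The coloring rule at a crossing. -/
def Tangle.ColoredAt (D : Tangle I O) (S τ : X × X → X × X) (C : D.Arc → X)
    (c : D.Crossing) : Prop :=
  match D.kind c with
  | CrossingKind.pos => S (D.colorsIn C c) = D.colorsOut C c
  | CrossingKind.neg => S (D.colorsOut C c) = D.colorsIn C c
  | CrossingKind.sing => τ (D.colorsIn C c) = D.colorsOut C c

/-- The set of colorings of a diagram by `(X, S, τ)`. -/
def Tangle.Coloring (D : Tangle I O) (S τ : X × X → X × X) : Type _ :=
  {C : D.Arc → X // ∀ c, D.ColoredAt S τ C c}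

/-- The Boltzmann weight of a crossing. -/
def Tangle.boltzmannWeight [Group H] (D : Tangle I O) (f h : X × X → H) (C : D.Arc → X)
    (c : D.Crossing) : H :=
  match D.kind c with
  | CrossingKind.pos => f (D.colorsIn C c)
  | CrossingKind.neg => (f (D.colorsOut C c))⁻¹
  | CrossingKind.sing => h (D.colorsIn C c)

/-- The passages that are recorded while travelling along a component: the under-passages of the
classical crossings, and both passages of a singular crossing. -/
def CrossingKind.counts : CrossingKind → Strand → Bool
  | CrossingKind.pos, s => decide (s = Strand.ltr)
  | CrossingKind.neg, s => decide (s = Strand.rtl)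
  | CrossingKind.sing, _ => true

/-- The contribution of the passage of the strand `p.2` through the crossing `p.1`. -/
def Tangle.passageWeight [Group H] (D : Tangle I O) (f h : X × X → H) (C : D.Arc → X)
    (p : D.Crossing × Strand) : H :=
  if (D.kind p.1).counts p.2 then D.boltzmannWeight f h C p.1 else 1

/-! ## Travelling along the components of a link diagram -/

open Classical in
/-- The semi-arc that follows `a` on its component, straight through the crossing at the end of `a`
(a circle without crossings is followed by itself). -/
noncomputable def LinkDiagram.next (D : LinkDiagram) (a : D.Arc) : D.Arc :=
  if hp : ∃ p, D.enter p = a then D.leave hp.choose else a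

open Classical in
/-- The contribution of the passage through the crossing at the end of `a` (if there is one). -/
noncomputable def LinkDiagram.arcWeight [Group H] (D : LinkDiagram) (f h : X × X → H)
    (C : D.Arc → X) (a : D.Arc) : H :=
  if hp : ∃ p, D.enter p = a then D.passageWeight f h C hp.choose else 1

/-- The components of the link: semi-arcs, up to travelling along the diagram. -/
def LinkDiagram.Component (D : LinkDiagram) : Type :=
  Quot (fun a b : D.Arc => LinkDiagram.next D a = b)

/-- The component that contains a semi-arc. -/
def LinkDiagram.component (D : LinkDiagram) (a : D.Arc) : LinkDiagram.Component D :=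
  Quot.mk _ a

/-- The ordered product of the weights met on travelling once along the component of the semi-arc
`a`, with base point on `a`. -/
noncomputable def LinkDiagram.componentProduct [Group H] (D : LinkDiagram) (f h : X × X → H)
    (C : D.Arc → X) (a : D.Arc) : H :=
  ((List.range (Function.minimalPeriod (LinkDiagram.next D) a)).map
    (fun i => LinkDiagram.arcWeight D f h C ((LinkDiagram.next D)^[i] a))).prod

end Colorings

/-! ## Gluing a local tangle into the rest of a diagram -/

/-- The pieces of semi-arcs that meet at a point of the boundary circle of the disc containing `T`:
the outgoing boundary points of `T` are the incoming ones of `W`, and conversely. -/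
inductive Tangle.Meets {m : ℕ} (W T : Tangle (Fin m) (Fin m)) : W.Arc ⊕ T.Arc → W.Arc ⊕ T.Arc → Prop
  | out (k : Fin m) : Tangle.Meets W T (Sum.inr (T.target k)) (Sum.inl (W.source k))
  | into (k : Fin m) : Tangle.Meets W T (Sum.inl (W.target k)) (Sum.inr (T.source k))

/-- The link diagram `D` is the union of the tangle `T` inside a disc and the tangle `W` outside of
it: the crossings of `D` are those of `W` and of `T`, and the semi-arcs of `D` are the classes of
pieces of semi-arcs that are joined across the boundary of the disc. -/
structure Gluing {m : ℕ} (W T : Tangle (Fin m) (Fin m)) (D : LinkDiagram) where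
  crossing : W.Crossing ⊕ T.Crossing ≃ D.Crossing
  arc : W.Arc ⊕ T.Arc → D.Arc
  kind_outside : ∀ c, D.kind (crossing (Sum.inl c)) = W.kind c
  kind_inside : ∀ c, D.kind (crossing (Sum.inr c)) = T.kind c
  enter_outside : ∀ c s, D.enter (crossing (Sum.inl c), s) = arc (Sum.inl (W.enter (c, s)))
  enter_inside : ∀ c s, D.enter (crossing (Sum.inr c), s) = arc (Sum.inr (T.enter (c, s)))
  leave_outside : ∀ c s, D.leave (crossing (Sum.inl c), s) = arc (Sum.inl (W.leave (c, s)))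
  leave_inside : ∀ c s, D.leave (crossing (Sum.inr c), s) = arc (Sum.inr (T.leave (c, s)))
  arc_surjective : Function.Surjective arc
  arc_eq_iff : ∀ x y, arc x = arc y ↔ Relation.EqvGen (Tangle.Meets W T) x y

/-! ## The local pictures of the Reidemeister moves -/

/-- A tangle made of `m` strands, the `k`-th one running from the `k`-th incoming to the `k`-th
outgoing boundary point, each of which passes through crossings `n` times. Here `pass (c, s) = (k, j)`
means that the strand `s` of the crossing `c` is the `j`-th passage of the strand `k`; the semi-arcs
of the strand `k` are `(k, 0), …, (k, n)`. -/
def strandTangle {m n : ℕ} {K : Type} [Finite K] (kind : K → CrossingKind)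
    (pass : K × Strand → Fin m × Fin n) (hpass : Function.Bijective pass) :
    Tangle (Fin m) (Fin m) where
  Crossing := K
  Arc := Fin m × Fin (n + 1)
  finite_crossing := inferInstance
  finite_arc := inferInstance
  kind := kind
  enter p := ((pass p).1, (pass p).2.castSucc)
  leave p := ((pass p).1, (pass p).2.succ)
  source k := (k, 0)
  target k := (k, Fin.last n)
  end_injective := by
    refine Function.Injective.sumElim ?_ ?_ ?_
    · intro p q hpq
      simp only [Prod.mk.injEq, Fin.castSucc_inj] at hpq
      exact hpass.1 (Prod.ext hpq.1 hpq.2)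
    · intro k l hkl
      simpa using hkl
    · intro p k hpk
      simp only [Prod.mk.injEq] at hpk
      exact (Fin.castSucc_lt_last _).ne hpk.2
  start_injective := by
    refine Function.Injective.sumElim ?_ ?_ ?_
    · intro p q hpq
      simp only [Prod.mk.injEq, Fin.succ_inj] at hpq
      exact hpass.1 (Prod.ext hpq.1 hpq.2)
    · intro k l hkl
      simpa using hkl
    · intro p k hpk
      simp only [Prod.mk.injEq] at hpk
      exact Fin.succ_ne_zero _ hpk.2
  range_eq := by
    have hL : Set.range (Sum.elim (fun p => ((pass p).1, (pass p).2.castSucc))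
        (fun k : Fin m => (k, Fin.last n))) = Set.univ := by
      refine Set.eq_univ_of_forall ?_
      rintro ⟨k, j⟩
      induction j using Fin.lastCases with
      | last => exact ⟨Sum.inr k, rfl⟩
      | cast j =>
        obtain ⟨p, hp⟩ := hpass.2 (k, j)
        exact ⟨Sum.inl p, by simp [hp]⟩
    have hR : Set.range (Sum.elim (fun p => ((pass p).1, (pass p).2.succ))
        (fun k : Fin m => (k, (0 : Fin (n + 1))))) = Set.univ := by
      refine Set.eq_univ_of_forall ?_
      rintro ⟨k, j⟩
      induction j using Fin.cases with
      | zero => exact ⟨Sum.inr k, rfl⟩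
      | succ j =>
        obtain ⟨p, hp⟩ := hpass.2 (k, j)
        exact ⟨Sum.inl p, by simp [hp]⟩
    rw [hL, hR]

instance : Fintype Strand := ⟨{Strand.ltr, Strand.rtl}, fun s => by cases s <;> decide⟩

/-- The kind of a classical crossing of given sign. -/
def CrossingKind.ofSign (positive : Bool) : CrossingKind :=
  if positive then CrossingKind.pos else CrossingKind.neg

/-- `m` strands without any crossing. -/
def plainTangle (m : ℕ) : Tangle (Fin m) (Fin m) :=
  strandTangle (n := 0) (K := Empty) (fun c => c.elim) (fun p => p.1.elim)
    ⟨fun p => p.1.elim, fun q => q.2.elim0⟩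

/-- One strand with a curl: the loop joins the two left ends of the crossing if `left` holds, and
its two right ends otherwise. -/
def curlPass (left : Bool) (p : Unit × Strand) : Fin 1 × Fin 2 :=
  match p.2 with
  | Strand.ltr => (0, if left then 1 else 0)
  | Strand.rtl => (0, if left then 0 else 1)

/-- The curl with a crossing of the given sign and the given side of the loop. -/
def curlTangle (positive left : Bool) : Tangle (Fin 1) (Fin 1) :=
  strandTangle (fun _ : Unit => CrossingKind.ofSign positive) (curlPass left)
    (by cases left <;> decide)

/-- Two crossings, of opposite signs, of the over-strand `0` with the under-strand `1`: `0` passes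
first through the crossing `0`, then through the crossing `1`, and `1` passes through them in the
same order if `parallel` holds, and in the opposite order otherwise. -/
def bigonPass (positive parallel : Bool) (p : Fin 2 × Strand) : Fin 2 × Fin 2 :=
  if (CrossingKind.ofSign (if p.1 = 0 then positive else !positive)).counts p.2 then
    (1, if parallel then p.1 else p.1.rev)
  else (0, p.1)

/-- The two-crossing side of the second move. -/
def bigonTangle (positive parallel : Bool) : Tangle (Fin 2) (Fin 2) :=
  strandTangle (fun c : Fin 2 => CrossingKind.ofSign (if c = 0 then positive else !positive))
    (bigonPass positive parallel) (by cases positive <;> cases parallel <;> decide)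

/-- The pairs of strands among three strands `0, 1, 2`. -/
inductive StrandPair where
  | p01 | p02 | p12
  deriving DecidableEq

instance : Fintype StrandPair :=
  ⟨{StrandPair.p01, StrandPair.p02, StrandPair.p12}, fun s => by cases s <;> decide⟩

/-- The value attached to a pair of strands. -/
def StrandPair.pick {α : Type} (a01 a02 a12 : α) : StrandPair → α
  | StrandPair.p01 => a01
  | StrandPair.p02 => a02
  | StrandPair.p12 => a12

/-- The lower strand of a pair. -/
def StrandPair.fst : StrandPair → Fin 3 := StrandPair.pick 0 0 1

/-- The higher strand of a pair. -/
def StrandPair.snd : StrandPair → Fin 3 := StrandPair.pick 1 2 2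

/-- Three oriented straight lines `0, 1, 2` in general position in the plane form a triangle. For
`i < j` let `bij` say whether `det (uᵢ, uⱼ) > 0` for the direction vectors `uᵢ, uⱼ`, so that then `j`
is the strand `ltr` of the crossing of `i` and `j`, and `i` is the strand `rtl`. The line `i` meets
the lower one `j` of the two other lines before the higher one `k` if and only if
`bᵢⱼ xor bᵢₖ xor d` holds, where the bit `d` does not depend on `i`; it tells the two
triangles with the given directions apart, and moving one line across the crossing of the other two
changes `d` and nothing else. -/
def trianglePass (b01 b02 b12 d : Bool) (p : StrandPair × Strand) : Fin 3 × Fin 2 :=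
  let line : Fin 3 :=
    if (StrandPair.pick b01 b02 b12 p.1 = true ↔ p.2 = Strand.ltr) then p.1.snd else p.1.fst
  let lowerFirst : Bool :=
    if line = 0 then (b01 ^^ b02) ^^ d
    else if line = 1 then (b01 ^^ b12) ^^ d
    else (b02 ^^ b12) ^^ d
  -- whether the other line of the pair is the lower one of the two lines different from `line`
  let isLower : Bool :=
    if line = 0 then decide (p.1 = StrandPair.p01)
    else if line = 1 then decide (p.1 = StrandPair.p01)
    else decide (p.1 = StrandPair.p02)
  (line, if isLower = lowerFirst then 0 else 1)

/-- The triangle with given geometry and given kinds of its three crossings. -/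
def triangleTangle (b01 b02 b12 d : Bool) (k01 k02 k12 : CrossingKind) :
    Tangle (Fin 3) (Fin 3) :=
  strandTangle (StrandPair.pick k01 k02 k12) (trianglePass b01 b02 b12 d)
    (by cases b01 <;> cases b02 <;> cases b12 <;> cases d <;> decide)

/-- Two strands `0, 1` that cross at a singular crossing `true` and at a classical crossing `false`:
`first0` (resp. `first1`) says whether the strand `0` (resp. `1`) meets the singular crossing before
the classical one, and `ltr0` whether the strand `0` is the strand `ltr` of the singular crossing.
As the two crossings bound a bigon, `0` is then the strand `rtl` of the classical crossing. -/
def twistPass (ltr0 first0 first1 : Bool) (p : Bool × Strand) : Fin 2 × Fin 2 :=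
  let line : Fin 2 := if ((p.1 = ltr0) ↔ p.2 = Strand.ltr) then 0 else 1
  (line, if p.1 = (if line = 0 then first0 else first1) then 0 else 1)

/-- A singular crossing next to a classical crossing of the given sign, of the same two strands. -/
def twistTangle (positive ltr0 first0 first1 : Bool) : Tangle (Fin 2) (Fin 2) :=
  strandTangle (fun c : Bool => if c then CrossingKind.sing else CrossingKind.ofSign positive)
    (twistPass ltr0 first0 first1)
    (by cases ltr0 <;> cases first0 <;> cases first1 <;> decide)

/-- The local pictures `T`, `T'` before and after an oriented Reidemeister move, for all the
orientations of the strands. -/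
inductive ReidemeisterMove : {m : ℕ} → Tangle (Fin m) (Fin m) → Tangle (Fin m) (Fin m) → Prop
  /-- RI: a curl. -/
  | RI (positive left : Bool) : ReidemeisterMove (plainTangle 1) (curlTangle positive left)
  /-- RII: one strand is pushed over another one. -/
  | RII (positive parallel : Bool) :
      ReidemeisterMove (plainTangle 2) (bigonTangle positive parallel)
  /-- RIII: here `0` passes over `1` and `2`, and `1` over `2`; the crossing of `i` over `j` is
  positive if and only if `det (uᵢ, uⱼ) > 0`. -/
  | RIII (b01 b02 b12 d : Bool) :
      ReidemeisterMove
        (triangleTangle b01 b02 b12 d (CrossingKind.ofSign b01) (CrossingKind.ofSign b02)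
          (CrossingKind.ofSign b12))
        (triangleTangle b01 b02 b12 (!d) (CrossingKind.ofSign b01) (CrossingKind.ofSign b02)
          (CrossingKind.ofSign b12))
  /-- RIV: the strand `0` passes over (`under = false`) or under (`under = true`) the singular
  crossing of `1` and `2`. -/
  | RIV (under b01 b02 b12 d : Bool) :
      ReidemeisterMove
        (triangleTangle b01 b02 b12 d (CrossingKind.ofSign (b01 ^^ under))
          (CrossingKind.ofSign (b02 ^^ under)) CrossingKind.sing)
        (triangleTangle b01 b02 b12 (!d) (CrossingKind.ofSign (b01 ^^ under))
          (CrossingKind.ofSign (b02 ^^ under)) CrossingKind.sing)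
  /-- RV: a classical crossing of the two strands of a singular crossing is moved to the other side
  of the singular crossing (which is turned over), and keeps its sign. -/
  | RV (positive ltr0 first0 first1 : Bool) :
      ReidemeisterMove (twistTangle positive ltr0 first0 first1)
        (twistTangle positive (!ltr0) (!first0) (!first1))
  /-- The inverse of a move is a move. -/
  | symm {m : ℕ} {T T' : Tangle (Fin m) (Fin m)} :
      ReidemeisterMove T T' → ReidemeisterMove T' T

/-!
# Invariance of the coloring products under the moves of singular link diagrams

A diagram `D` is the union of a tangle `W` outside of a disc and a tangle `T` inside of it, and a
move replaces `T` by another tangle `T'` whose `k`-th strand has the same end points. The proof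
separates the algebra inside of the disc from the bookkeeping outside of it.

*Inside of the disc.* Each coloring of `T` has a partner among the colorings of `T'` with the same
colors at the boundary and with exactly the same product of weights along each strand
(`ColoringsMatch`), and colorings are determined by their boundary (`DeterminedByBoundary`). For
all the tangles with crossings the latter holds because the two boundary ends at each crossing are
adjacent, and two adjacent colors at a crossing determine the other two
(`determinedByBoundary_two`).

For the third and the fourth move, a strand slides over or under a crossing of kind `κ`. The
colors of the twelve semi-arcs involved sit on the edges of a cube whose six faces are the
coloring rules (`OverCube`, `UnderCube`). The three crossings on either side of the move are three
faces with a common vertex and the opposite three faces. The Yang-Baxter equation and its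
analogues for `τ` provide the opposite faces for one vertex, non-degeneracy provides them for the
other seven, and the eight vertices account for all the orientations of the strands, including
those where the triangle is coherently oriented. The cocycle conditions become equations between
weights of opposite faces, which do not depend on the vertex. The Yang-Baxter equation is the case
of a classical crossing, and the slide conditions of a singular pair are the case `κ = sing`.

For the fifth move the classical and the singular crossing have parallel or antiparallel strands.
The parallel case is `τ S = S τ` together with the cocycle conditions `c3` and `c4`
(`VerticalTwist`). In the antiparallel case (`RightTwist`, and `LeftTwist` with `under` and `over`
exchanged) the classical crossing is continued to a strand that slides under the singular crossing
and becomes a curl there; what remains is the parallel case, and a second slide of a strand over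
the singular crossing leads to the other side of the move. This uses the fixed points of `S`,
whose weights are trivial.

*Outside of the disc.* Both the walk along the semi-arcs of `D` and the walk along the outer
pieces of semi-arcs, with the disc traversed in one step, are compared with the walk along all
pieces of semi-arcs of `W` and `T`. The products along the cycles agree, up to the choice of
the base point, which conjugates the product: a first return map has the same products
(`cycleProduct_firstReturn`), the outer walk is a first return map of the walk along all pieces,
and the latter and the walk along `D` have the same first return map to the passages of crossings. The walk along the outer pieces depends only on `W`, on the colors outside
of the disc and on the products along the strands inside, so that it is the same for `D` and `D'`;
its cycles are the components of both diagrams (`Gluing.exists_component_equiv`).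
-/

/-! ### The coloring rule and the weights at a single crossing -/

section Rules

variable {X H : Type*}

/-- The coloring rule of a crossing of a given kind, as a relation between the pair of colors above
and the pair of colors below the crossing. -/
def CrossingKind.Rule (S τ : X × X → X × X) : CrossingKind → X × X → X × X → Prop
  | CrossingKind.pos, p, q => S p = q
  | CrossingKind.neg, p, q => S q = p
  | CrossingKind.sing, p, q => τ p = q

theorem CrossingKind.rule_pos (S τ : X × X → X × X) (p q : X × X) :
    CrossingKind.pos.Rule S τ p q ↔ S p = q := Iff.rfl

theorem CrossingKind.rule_neg (S τ : X × X → X × X) (p q : X × X) :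
    CrossingKind.neg.Rule S τ p q ↔ S q = p := Iff.rfl

theorem CrossingKind.rule_sing (S τ : X × X → X × X) (p q : X × X) :
    CrossingKind.sing.Rule S τ p q ↔ τ p = q := Iff.rfl

/-- The contribution of a strand passing through a crossing of a given kind with the pair `p` of
colors above and the pair `q` of colors below; it is `1` for the over-strand. -/
def CrossingKind.weight [Group H] (f h : X × X → H) : CrossingKind → Strand → X × X → X × X → H
  | CrossingKind.pos, Strand.ltr, p, _ => f p
  | CrossingKind.pos, Strand.rtl, _, _ => 1
  | CrossingKind.neg, Strand.ltr, _, _ => 1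
  | CrossingKind.neg, Strand.rtl, _, q => (f q)⁻¹
  | CrossingKind.sing, _, p, _ => h p

theorem Tangle.coloredAt_iff {I O : Type} (D : Tangle I O) (S τ : X × X → X × X) (C : D.Arc → X)
    (c : D.Crossing) :
    D.ColoredAt S τ C c ↔ (D.kind c).Rule S τ (D.colorsIn C c) (D.colorsOut C c) := by
  unfold Tangle.ColoredAt CrossingKind.Rule
  cases D.kind c <;> rfl

theorem Tangle.passageWeight_eq_weight [Group H] {I O : Type} (D : Tangle I O) (f h : X × X → H)
    (C : D.Arc → X) (p : D.Crossing × Strand) :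
    D.passageWeight f h C p =
      (D.kind p.1).weight f h p.2 (D.colorsIn C p.1) (D.colorsOut C p.1) := by
  obtain ⟨c, s⟩ := p
  unfold Tangle.passageWeight Tangle.boltzmannWeight CrossingKind.weight
  cases D.kind c <;> cases s <;> simp [CrossingKind.counts]

namespace IsNondegenerate

variable {F : X × X → X × X}

theorem eq_of_fst (hF : IsNondegenerate F) {x y y' : X} (h : (F (x, y)).1 = (F (x, y')).1) :
    y = y' :=
  (hF.left_invertible x _).unique h rfl

theorem eq_of_snd (hF : IsNondegenerate F) {x x' y : X} (h : (F (x, y)).2 = (F (x', y)).2) :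
    x = x' :=
  (hF.right_invertible y _).unique h rfl

/-- The four colors at a crossing are determined by the two left ones. -/
theorem right_unique (hF : IsNondegenerate F) {x y z w y' w' : X} (h : F (x, y) = (z, w))
    (h' : F (x, y') = (z, w')) : y = y' ∧ w = w' := by
  obtain rfl : y = y' := hF.eq_of_fst (by rw [h, h'])
  exact ⟨rfl, congrArg Prod.snd (h.symm.trans h')⟩

/-- The four colors at a crossing are determined by the two right ones. -/
theorem left_unique (hF : IsNondegenerate F) {x y z w x' z' : X} (h : F (x, y) = (z, w))
    (h' : F (x', y) = (z', w)) : x = x' ∧ z = z' := by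
  obtain rfl : x = x' := hF.eq_of_snd (by rw [h, h'])
  exact ⟨rfl, congrArg Prod.fst (h.symm.trans h')⟩

theorem top_unique (hF : IsNondegenerate F) {x y x' y' z w : X} (h : F (x, y) = (z, w))
    (h' : F (x', y') = (z, w)) : x = x' ∧ y = y' :=
  Prod.mk.inj (hF.bijective.1 (h.trans h'.symm))

theorem exists_right (hF : IsNondegenerate F) (x z : X) : ∃ y w, F (x, y) = (z, w) :=
  let ⟨y, hy, _⟩ := hF.left_invertible x z
  ⟨y, _, Prod.ext hy rfl⟩

theorem exists_left (hF : IsNondegenerate F) (y w : X) : ∃ x z, F (x, y) = (z, w) :=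
  let ⟨x, hx, _⟩ := hF.right_invertible y w
  ⟨x, _, Prod.ext rfl hx⟩

theorem exists_top (hF : IsNondegenerate F) (z w : X) : ∃ x y, F (x, y) = (z, w) :=
  let ⟨p, hp⟩ := hF.bijective.2 (z, w)
  ⟨p.1, p.2, hp⟩

end IsNondegenerate

theorem exists_bottom (F : X × X → X × X) (x y : X) : ∃ z w, F (x, y) = (z, w) := ⟨_, _, rfl⟩

variable {S τ : X × X → X × X}

theorem IsSingularPair.nondegenerateS (hS : IsSingularPair S τ) : IsNondegenerate S :=
  hS.biquandle.toIsNondegenerate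

theorem IsSingularPair.rule_exists_bottom (hS : IsSingularPair S τ) (κ : CrossingKind) (x y : X) :
    ∃ z w, κ.Rule S τ (x, y) (z, w) := by
  cases κ
  exacts [exists_bottom S x y, hS.nondegenerateS.exists_top x y, exists_bottom τ x y]

theorem IsSingularPair.rule_exists_top (hS : IsSingularPair S τ) (κ : CrossingKind) (z w : X) :
    ∃ x y, κ.Rule S τ (x, y) (z, w) := by
  cases κ
  exacts [hS.nondegenerateS.exists_top z w, exists_bottom S z w, hS.nondegenerate.exists_top z w]

theorem IsSingularPair.rule_bottom_unique (hS : IsSingularPair S τ) {κ : CrossingKind}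
    {x y z w z' w' : X} (h : κ.Rule S τ (x, y) (z, w)) (h' : κ.Rule S τ (x, y) (z', w')) :
    z = z' ∧ w = w' := by
  cases κ
  exacts [Prod.mk.inj (h.symm.trans h'), hS.nondegenerateS.top_unique h h',
    Prod.mk.inj (h.symm.trans h')]

theorem IsSingularPair.rule_top_unique (hS : IsSingularPair S τ) {κ : CrossingKind}
    {x y z w x' y' : X} (h : κ.Rule S τ (x, y) (z, w)) (h' : κ.Rule S τ (x', y') (z, w)) :
    x = x' ∧ y = y' := by
  cases κ
  exacts [hS.nondegenerateS.top_unique h h', Prod.mk.inj (h.symm.trans h'),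
    hS.nondegenerate.top_unique h h']

theorem IsSingularPair.rule_right_unique (hS : IsSingularPair S τ) {κ : CrossingKind}
    {x y z w y' w' : X} (h : κ.Rule S τ (x, y) (z, w)) (h' : κ.Rule S τ (x, y') (z, w')) :
    y = y' ∧ w = w' := by
  cases κ
  exacts [hS.nondegenerateS.right_unique h h', (hS.nondegenerateS.right_unique h h').symm,
    hS.nondegenerate.right_unique h h']

theorem IsSingularPair.rule_left_unique (hS : IsSingularPair S τ) {κ : CrossingKind}
    {x y z w x' z' : X} (h : κ.Rule S τ (x, y) (z, w)) (h' : κ.Rule S τ (x', y) (z', w)) :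
    x = x' ∧ z = z' := by
  cases κ
  exacts [hS.nondegenerateS.left_unique h h', (hS.nondegenerateS.left_unique h h').symm,
    hS.nondegenerate.left_unique h h']

namespace IsBiquandle

theorem exists_fixed_right (hS : IsBiquandle S) (x : X) : ∃ y, S (x, y) = (x, y) :=
  let ⟨s, hs⟩ := hS.diagonal
  ⟨s x, (hs x _).2 rfl⟩

theorem exists_fixed_left (hS : IsBiquandle S) (y : X) : ∃ x, S (x, y) = (x, y) :=
  let ⟨s, hs⟩ := hS.diagonal
  ⟨s.symm y, (hs _ y).2 (s.apply_symm_apply y).symm⟩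

/-- If the two left colors at a crossing agree, then so do the two right ones. -/
theorem right_eq_of_left_eq (hS : IsBiquandle S) {x y w : X} (h : S (x, y) = (x, w)) : w = y := by
  obtain ⟨t, ht⟩ := hS.exists_fixed_right x
  obtain ⟨rfl, rfl⟩ := hS.right_unique h ht
  rfl

/-- If the two right colors at a crossing agree, then so do the two left ones. -/
theorem left_eq_of_right_eq (hS : IsBiquandle S) {x y z : X} (h : S (x, y) = (z, y)) : z = x := by
  obtain ⟨t, ht⟩ := hS.exists_fixed_left y
  obtain ⟨rfl, rfl⟩ := hS.left_unique h ht
  rfl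

end IsBiquandle

end Rules

/-! ### A strand sliding past a crossing -/

section Slide

variable {X H : Type*} {S τ : X × X → X × X} {κ : CrossingKind}

/-- The colors of the twelve semi-arcs that occur when a strand slides over a crossing of kind `κ`,
as the edges of a cube: the crossing has colors `x y` above and `z w` below on one side of the
strand, and `x' y'` above and `z' w'` below on the other side; the strand has the colors `e, c, b`
when it passes above the crossing and `e, a, b` when it passes below. The six faces of the cube are
the coloring rules; opposite faces belong to the same pair of strands. -/
structure OverCube (S τ : X × X → X × X) (κ : CrossingKind) (x y z w x' y' z' w' a b c e : X) :
    Prop where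
  front : κ.Rule S τ (x, y) (z, w)
  back : κ.Rule S τ (x', y') (z', w')
  top_right : S (y, e) = (c, y')
  top_left : S (x, c) = (b, x')
  bottom_right : S (w, e) = (a, w')
  bottom_left : S (z, a) = (b, z')

/-- The analogue of `OverCube` for a strand sliding under a crossing; it has the colors `a, c, e`
above the crossing and `a, b, e` below. -/
structure UnderCube (S τ : X × X → X × X) (κ : CrossingKind) (x y z w x' y' z' w' a b c e : X) :
    Prop where
  front : κ.Rule S τ (x, y) (z, w)
  back : κ.Rule S τ (x', y') (z', w')
  top_left : S (a, x) = (x', c)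
  top_right : S (c, y) = (y', e)
  bottom_left : S (a, z) = (z', b)
  bottom_right : S (b, w) = (w', e)

/-- A rule `F` which commutes with sliding over extends to a cube from three faces. -/
theorem slide_over_aux {F : X × X → X × X}
    (hF : actLeft S ∘ actRight S ∘ actLeft F = actRight F ∘ actLeft S ∘ actRight S)
    {x y z w c e b x' y' a w' : X} (h : F (x, y) = (z, w)) (hy : S (y, e) = (c, y'))
    (hx : S (x, c) = (b, x')) (hw : S (w, e) = (a, w')) :
    ∃ z', F (x', y') = (z', w') ∧ S (z, a) = (b, z') := by
  have := congrFun hF (x, y, e)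
  simp only [Function.comp_apply, actLeft, actRight, h, hy, hx, hw, Prod.mk.injEq] at this
  obtain ⟨h1, h2⟩ := this
  exact ⟨(S (z, a)).2, h2.symm, Prod.ext h1 rfl⟩

theorem slide_under_aux {F : X × X → X × X}
    (hF : actRight S ∘ actLeft S ∘ actRight F = actLeft F ∘ actRight S ∘ actLeft S)
    {x y z w c e b x' y' a z' : X} (h : F (x, y) = (z, w)) (hx : S (a, x) = (x', c))
    (hy : S (c, y) = (y', e)) (hz : S (a, z) = (z', b)) :
    ∃ w', F (x', y') = (z', w') ∧ S (b, w) = (w', e) := by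
  have := congrFun hF (a, x, y)
  simp only [Function.comp_apply, actLeft, actRight, h, hy, hx, hz, Prod.mk.injEq] at this
  obtain ⟨h1, h2⟩ := this
  exact ⟨(F (x', y')).2, Prod.ext h1.symm rfl, h2⟩

theorem IsSingularPair.yangBaxter_over (hS : IsSingularPair S τ) :
    actLeft S ∘ actRight S ∘ actLeft S = actRight S ∘ actLeft S ∘ actRight S :=
  hS.biquandle.yang_baxter.symm

namespace OverCube

theorem of_front_top (hS : IsSingularPair S τ) {x y z w x' y' b c e : X}
    (h : κ.Rule S τ (x, y) (z, w)) (hy : S (y, e) = (c, y')) (hx : S (x, c) = (b, x')) :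
    ∃ a z' w', OverCube S τ κ x y z w x' y' z' w' a b c e := by
  obtain ⟨a, w', hw⟩ := exists_bottom S w e
  cases κ with
  | pos =>
    obtain ⟨z', h', hz⟩ := slide_over_aux hS.yangBaxter_over h hy hx hw
    exact ⟨a, z', w', h, h', hy, hx, hw, hz⟩
  | neg =>
    obtain ⟨b', z', hz⟩ := exists_bottom S z a
    obtain ⟨x'', h', hx'⟩ := slide_over_aux hS.yangBaxter_over h hw hz hy
    obtain ⟨rfl, rfl⟩ := Prod.mk.inj (hx.symm.trans hx')
    exact ⟨a, z', w', h, h', hy, hx, hw, hz⟩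
  | sing =>
    obtain ⟨z', h', hz⟩ := slide_over_aux hS.slide_over h hy hx hw
    exact ⟨a, z', w', h, h', hy, hx, hw, hz⟩

theorem of_front_right (hS : IsSingularPair S τ) {x y z w y' w' a c e : X}
    (h : κ.Rule S τ (x, y) (z, w)) (hy : S (y, e) = (c, y')) (hw : S (w, e) = (a, w')) :
    ∃ b x' z', OverCube S τ κ x y z w x' y' z' w' a b c e := by
  obtain ⟨b, x', hx⟩ := exists_bottom S x c
  obtain ⟨a₁, z', w₁, Q⟩ := of_front_top hS h hy hx
  obtain ⟨rfl, rfl⟩ := Prod.mk.inj (hw.symm.trans Q.bottom_right)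
  exact ⟨_, _, _, Q⟩

theorem of_front_bottom (hS : IsSingularPair S τ) {x y z w z' w' a b e : X}
    (h : κ.Rule S τ (x, y) (z, w)) (hw : S (w, e) = (a, w')) (hz : S (z, a) = (b, z')) :
    ∃ c x' y', OverCube S τ κ x y z w x' y' z' w' a b c e := by
  obtain ⟨c, y', hy⟩ := exists_bottom S y e
  obtain ⟨b₁, x', z₁, Q⟩ := of_front_right hS h hy hw
  obtain ⟨rfl, rfl⟩ := Prod.mk.inj (hz.symm.trans Q.bottom_left)
  exact ⟨_, _, _, Q⟩

theorem of_front_left (hS : IsSingularPair S τ) {x y z w x' z' a b c : X}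
    (h : κ.Rule S τ (x, y) (z, w)) (hx : S (x, c) = (b, x')) (hz : S (z, a) = (b, z')) :
    ∃ e y' w', OverCube S τ κ x y z w x' y' z' w' a b c e := by
  obtain ⟨e, y', hy⟩ := hS.nondegenerateS.exists_right y c
  obtain ⟨a₁, z₁, w', Q⟩ := of_front_top hS h hy hx
  obtain ⟨rfl, rfl⟩ := hS.nondegenerateS.right_unique hz Q.bottom_left
  exact ⟨_, _, _, Q⟩

theorem of_back_top (hS : IsSingularPair S τ) {x y x' y' z' w' b c e : X}
    (h : κ.Rule S τ (x', y') (z', w')) (hy : S (y, e) = (c, y')) (hx : S (x, c) = (b, x')) :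
    ∃ a z w, OverCube S τ κ x y z w x' y' z' w' a b c e := by
  obtain ⟨z, w, hf⟩ := hS.rule_exists_bottom κ x y
  obtain ⟨a, z₁, w₁, Q⟩ := of_front_top hS hf hy hx
  obtain ⟨rfl, rfl⟩ := hS.rule_bottom_unique h Q.back
  exact ⟨_, _, _, Q⟩

theorem of_back_left (hS : IsSingularPair S τ) {x z x' y' z' w' a b c : X}
    (h : κ.Rule S τ (x', y') (z', w')) (hx : S (x, c) = (b, x')) (hz : S (z, a) = (b, z')) :
    ∃ e y w, OverCube S τ κ x y z w x' y' z' w' a b c e := by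
  obtain ⟨y, e, hy⟩ := hS.nondegenerateS.exists_top c y'
  obtain ⟨a₁, z₁, w, Q⟩ := of_back_top hS h hy hx
  obtain ⟨rfl, rfl⟩ := hS.nondegenerateS.top_unique hz Q.bottom_left
  exact ⟨_, _, _, Q⟩

theorem of_back_right (hS : IsSingularPair S τ) {y w x' y' z' w' a c e : X}
    (h : κ.Rule S τ (x', y') (z', w')) (hy : S (y, e) = (c, y')) (hw : S (w, e) = (a, w')) :
    ∃ b x z, OverCube S τ κ x y z w x' y' z' w' a b c e := by
  obtain ⟨x, b, hx⟩ := hS.nondegenerateS.exists_left c x'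
  obtain ⟨a₁, z, w₁, Q⟩ := of_back_top hS h hy hx
  obtain ⟨rfl, rfl⟩ := hS.nondegenerateS.left_unique hw Q.bottom_right
  exact ⟨_, _, _, Q⟩

theorem of_back_bottom (hS : IsSingularPair S τ) {z w x' y' z' w' a b e : X}
    (h : κ.Rule S τ (x', y') (z', w')) (hw : S (w, e) = (a, w')) (hz : S (z, a) = (b, z')) :
    ∃ c x y, OverCube S τ κ x y z w x' y' z' w' a b c e := by
  obtain ⟨x, y, hf⟩ := hS.rule_exists_top κ z w
  obtain ⟨c, x₁, y₁, Q⟩ := of_front_bottom hS hf hw hz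
  obtain ⟨rfl, rfl⟩ := hS.rule_top_unique h Q.back
  exact ⟨_, _, _, Q⟩

variable [Group H] {f h : X × X → H} {x y z w x' y' z' w' a b c e : X}

theorem weight_ltr (hfh : IsNonCommCocyclePair S τ f h)
    (Q : OverCube S τ κ x y z w x' y' z' w' a b c e) :
    f (x, c) * κ.weight f h Strand.ltr (x', y') (z', w') =
      κ.weight f h Strand.ltr (x, y) (z, w) * f (w, e) := by
  obtain ⟨h1, h2, hy, hx, hw, hz⟩ := Q
  cases κ with
  | pos =>
    have := hfh.f1 x y e
    simp only [CrossingKind.Rule] at h1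
    simp only [h1, hy, hx] at this
    exact this.symm
  | neg =>
    have := hfh.f2 z w e
    simp only [CrossingKind.Rule] at h1
    simp only [h1, hy] at this
    simpa [CrossingKind.weight] using this
  | sing =>
    have := hfh.c1 x y e
    simp only [CrossingKind.Rule] at h1
    simp only [h1, hy, hx] at this
    exact this

theorem weight_rtl (hfh : IsNonCommCocyclePair S τ f h)
    (Q : OverCube S τ κ x y z w x' y' z' w' a b c e) :
    f (y, e) * κ.weight f h Strand.rtl (x', y') (z', w') =
      κ.weight f h Strand.rtl (x, y) (z, w) * f (z, a) := by
  obtain ⟨h1, h2, hy, hx, hw, hz⟩ := Q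
  cases κ with
  | pos =>
    have := hfh.f2 x y e
    simp only [CrossingKind.Rule] at h1
    simp only [h1, hw] at this
    simpa [CrossingKind.weight] using this.symm
  | neg =>
    have := hfh.f1 z w e
    simp only [CrossingKind.Rule] at h1
    simp only [h1, hw, hz] at this
    simp only [CrossingKind.weight]
    rw [eq_inv_mul_iff_mul_eq, ← mul_assoc, this, mul_inv_cancel_right]
  | sing =>
    have := hfh.c2 x y e
    simp only [CrossingKind.Rule] at h1
    simp only [h1, hy, hx, hw] at this
    exact this

end OverCube

namespace UnderCube

theorem of_front_top (hS : IsSingularPair S τ) {x y z w x' y' a c e : X}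
    (h : κ.Rule S τ (x, y) (z, w)) (hx : S (a, x) = (x', c)) (hy : S (c, y) = (y', e)) :
    ∃ b z' w', UnderCube S τ κ x y z w x' y' z' w' a b c e := by
  obtain ⟨z', b, hz⟩ := exists_bottom S a z
  cases κ with
  | pos =>
    obtain ⟨w', h', hw⟩ := slide_under_aux hS.biquandle.yang_baxter h hx hy hz
    exact ⟨b, z', w', h, h', hx, hy, hz, hw⟩
  | neg =>
    obtain ⟨w', e', hw⟩ := exists_bottom S b w
    obtain ⟨y'', h', hy'⟩ := slide_under_aux hS.biquandle.yang_baxter h hz hw hx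
    obtain ⟨rfl, rfl⟩ := Prod.mk.inj (hy.symm.trans hy')
    exact ⟨b, z', w', h, h', hx, hy, hz, hw⟩
  | sing =>
    obtain ⟨w', h', hw⟩ := slide_under_aux hS.slide_under h hx hy hz
    exact ⟨b, z', w', h, h', hx, hy, hz, hw⟩

theorem of_front_left (hS : IsSingularPair S τ) {x y z w x' z' a b c : X}
    (h : κ.Rule S τ (x, y) (z, w)) (hx : S (a, x) = (x', c)) (hz : S (a, z) = (z', b)) :
    ∃ e y' w', UnderCube S τ κ x y z w x' y' z' w' a b c e := by
  obtain ⟨y', e, hy⟩ := exists_bottom S c y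
  obtain ⟨b₁, z₁, w', Q⟩ := of_front_top hS h hx hy
  obtain ⟨rfl, rfl⟩ := Prod.mk.inj (hz.symm.trans Q.bottom_left)
  exact ⟨_, _, _, Q⟩

theorem of_front_bottom (hS : IsSingularPair S τ) {x y z w z' w' a b e : X}
    (h : κ.Rule S τ (x, y) (z, w)) (hz : S (a, z) = (z', b)) (hw : S (b, w) = (w', e)) :
    ∃ c x' y', UnderCube S τ κ x y z w x' y' z' w' a b c e := by
  obtain ⟨x', c, hx⟩ := exists_bottom S a x
  obtain ⟨e₁, y', w₁, Q⟩ := of_front_left hS h hx hz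
  obtain ⟨rfl, rfl⟩ := Prod.mk.inj (hw.symm.trans Q.bottom_right)
  exact ⟨_, _, _, Q⟩

theorem of_front_right (hS : IsSingularPair S τ) {x y z w y' w' b c e : X}
    (h : κ.Rule S τ (x, y) (z, w)) (hy : S (c, y) = (y', e)) (hw : S (b, w) = (w', e)) :
    ∃ a x' z', UnderCube S τ κ x y z w x' y' z' w' a b c e := by
  obtain ⟨a, x', hx⟩ := hS.nondegenerateS.exists_left x c
  obtain ⟨b₁, z', w₁, Q⟩ := of_front_top hS h hx hy
  obtain ⟨rfl, rfl⟩ := hS.nondegenerateS.left_unique hw Q.bottom_right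
  exact ⟨_, _, _, Q⟩

theorem of_back_top (hS : IsSingularPair S τ) {x y x' y' z' w' a c e : X}
    (h : κ.Rule S τ (x', y') (z', w')) (hx : S (a, x) = (x', c)) (hy : S (c, y) = (y', e)) :
    ∃ b z w, UnderCube S τ κ x y z w x' y' z' w' a b c e := by
  obtain ⟨z, w, hf⟩ := hS.rule_exists_bottom κ x y
  obtain ⟨b, z₁, w₁, Q⟩ := of_front_top hS hf hx hy
  obtain ⟨rfl, rfl⟩ := hS.rule_bottom_unique h Q.back
  exact ⟨_, _, _, Q⟩

theorem of_back_left (hS : IsSingularPair S τ) {x z x' y' z' w' a b c : X}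
    (h : κ.Rule S τ (x', y') (z', w')) (hx : S (a, x) = (x', c)) (hz : S (a, z) = (z', b)) :
    ∃ e y w, UnderCube S τ κ x y z w x' y' z' w' a b c e := by
  obtain ⟨y, e, hy⟩ := hS.nondegenerateS.exists_right c y'
  obtain ⟨b₁, z₁, w, Q⟩ := of_back_top hS h hx hy
  obtain ⟨rfl, rfl⟩ := hS.nondegenerateS.right_unique hz Q.bottom_left
  exact ⟨_, _, _, Q⟩

theorem of_back_right (hS : IsSingularPair S τ) {y w x' y' z' w' b c e : X}
    (h : κ.Rule S τ (x', y') (z', w')) (hy : S (c, y) = (y', e)) (hw : S (b, w) = (w', e)) :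
    ∃ a x z, UnderCube S τ κ x y z w x' y' z' w' a b c e := by
  obtain ⟨a, x, hx⟩ := hS.nondegenerateS.exists_top x' c
  obtain ⟨b₁, z, w₁, Q⟩ := of_back_top hS h hx hy
  obtain ⟨rfl, rfl⟩ := hS.nondegenerateS.top_unique hw Q.bottom_right
  exact ⟨_, _, _, Q⟩

theorem of_back_bottom (hS : IsSingularPair S τ) {z w x' y' z' w' a b e : X}
    (h : κ.Rule S τ (x', y') (z', w')) (hz : S (a, z) = (z', b)) (hw : S (b, w) = (w', e)) :
    ∃ c x y, UnderCube S τ κ x y z w x' y' z' w' a b c e := by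
  obtain ⟨x, y, hf⟩ := hS.rule_exists_top κ z w
  obtain ⟨c, x₁, y₁, Q⟩ := of_front_bottom hS hf hz hw
  obtain ⟨rfl, rfl⟩ := hS.rule_top_unique h Q.back
  exact ⟨_, _, _, Q⟩

variable [Group H] {f h : X × X → H} {x y z w x' y' z' w' a b c e : X}

theorem weight_strand (hfh : IsNonCommCocyclePair S τ f h)
    (Q : UnderCube S τ κ x y z w x' y' z' w' a b c e) :
    f (a, x) * f (c, y) = f (a, z) * f (b, w) := by
  obtain ⟨h1, h2, hx, hy, hz, hw⟩ := Q
  cases κ with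
  | pos =>
    have := hfh.f1 a x y
    simp only [CrossingKind.Rule] at h1
    simp only [h1, hx, hz] at this
    exact this
  | neg =>
    have := hfh.f1 a z w
    simp only [CrossingKind.Rule] at h1
    simp only [h1, hx, hz] at this
    exact this.symm
  | sing =>
    have := hfh.f4 a x y
    simp only [CrossingKind.Rule] at h1
    simp only [h1, hx, hz] at this
    exact this

theorem weight_crossing (hfh : IsNonCommCocyclePair S τ f h)
    (Q : UnderCube S τ κ x y z w x' y' z' w' a b c e) (s : Strand) :
    κ.weight f h s (x', y') (z', w') = κ.weight f h s (x, y) (z, w) := by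
  obtain ⟨h1, h2, hx, hy, hz, hw⟩ := Q
  have hf := hfh.f2 a x y
  have hg := hfh.f2 a z w
  have hh := hfh.h1 a x y
  simp only [hx, hy, hz, hw] at hf hg hh
  cases κ <;> cases s <;> simp [CrossingKind.weight, hf, hg, hh]

end UnderCube

end Slide

/-! ### A classical crossing moving past a singular crossing of the same two strands -/

section Twist

variable {X H : Type*} {S τ : X × X → X × X}

/-- The colors of the semi-arcs when a classical crossing moves from above to below a singular
crossing, as a commutative square of maps `S` and `τ`. -/
structure VerticalTwist (S τ : X × X → X × X) (x y z w x' y' z' w' : X) : Prop where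
  above : S (x, y) = (x', y')
  sing' : τ (x', y') = (z', w')
  sing : τ (x, y) = (z, w)
  below : S (z, w) = (z', w')

/-- The colors of the semi-arcs when a classical crossing moves from the right side of a singular
crossing to its left side, and the singular crossing is turned over. Both singular crossings are
seen from the direction in which both of their strands point down, so that the classical crossing is
on the right of both of them. -/
structure RightTwist (S τ : X × X → X × X) (x y z w u v p q : X) : Prop where
  sing : τ (x, y) = (z, w)
  cross : S (u, w) = (v, y)
  sing' : τ (u, p) = (v, q)
  cross' : S (x, q) = (z, p)

/-- The mirror image of `RightTwist`: the classical crossing is on the left of both singular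
crossings. -/
structure LeftTwist (S τ : X × X → X × X) (x y z w t r p q : X) : Prop where
  sing : τ (x, y) = (z, w)
  cross : S (z, t) = (x, r)
  sing' : τ (p, t) = (q, r)
  cross' : S (q, y) = (p, w)

theorem IsSingularPair.comm_apply (hS : IsSingularPair S τ) (p : X × X) : τ (S p) = S (τ p) :=
  congrFun hS.comm p

namespace VerticalTwist

theorem of_above_sing (hS : IsSingularPair S τ) {x y z w x' y' : X}
    (h : S (x, y) = (x', y')) (ht : τ (x, y) = (z, w)) :
    ∃ z' w', VerticalTwist S τ x y z w x' y' z' w' :=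
  ⟨(S (z, w)).1, (S (z, w)).2, h, by rw [← h, hS.comm_apply, ht], ht, rfl⟩

theorem of_above_sing' (hS : IsSingularPair S τ) {x y x' y' z' w' : X}
    (h : S (x, y) = (x', y')) (ht : τ (x', y') = (z', w')) :
    ∃ z w, VerticalTwist S τ x y z w x' y' z' w' :=
  ⟨(τ (x, y)).1, (τ (x, y)).2, h, ht, rfl, by rw [← ht, ← h, hS.comm_apply]⟩

theorem of_sing_below (hS : IsSingularPair S τ) {x y z w z' w' : X}
    (ht : τ (x, y) = (z, w)) (h : S (z, w) = (z', w')) :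
    ∃ x' y', VerticalTwist S τ x y z w x' y' z' w' :=
  ⟨(S (x, y)).1, (S (x, y)).2, rfl, by rw [← h, ← ht, ← hS.comm_apply], ht, h⟩

theorem of_sing'_below (hS : IsSingularPair S τ) {z w x' y' z' w' : X}
    (ht : τ (x', y') = (z', w')) (h : S (z, w) = (z', w')) :
    ∃ x y, VerticalTwist S τ x y z w x' y' z' w' := by
  obtain ⟨x, y, hxy⟩ := hS.nondegenerateS.exists_top x' y'
  refine ⟨x, y, hxy, ht, ?_, h⟩
  apply hS.nondegenerateS.bijective.1
  rw [← hS.comm_apply, hxy, ht, h]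

variable [Group H] {f h : X × X → H} {x y z w x' y' z' w' : X}

theorem weight_ltr (hfh : IsNonCommCocyclePair S τ f h)
    (Q : VerticalTwist S τ x y z w x' y' z' w') : h (x, y) = f (x, y) * h (x', y') := by
  rw [hfh.c3, Q.above]

theorem weight_rtl (hfh : IsNonCommCocyclePair S τ f h)
    (Q : VerticalTwist S τ x y z w x' y' z' w') : h (x', y') = h (x, y) * f (z, w) := by
  rw [← Q.above, hfh.c4, Q.sing]

end VerticalTwist

namespace RightTwist

theorem symm {x y z w u v p q : X} (Q : RightTwist S τ x y z w u v p q) :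
    RightTwist S τ u p v q x z y w :=
  ⟨Q.sing', Q.cross', Q.sing, Q.cross⟩

/-- The classical crossing is traded for a curl by sliding one strand under the singular crossing;
then a crossing moves from above to below the singular crossing, and a second slide, over the
singular crossing, creates a curl on the other side. The colors of the auxiliary diagrams give the
equation between the weights as well. -/
theorem of_sing_cross_aux (hS : IsSingularPair S τ) {x y z w u v : X} (ht : τ (x, y) = (z, w))
    (hc : S (u, w) = (v, y)) :
    ∃ p q, RightTwist S τ x y z w u v p q ∧
      ∀ {H : Type*} [Group H] {f h : X × X → H}, IsNonCommCocyclePair S τ f h →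
        f (u, w) * h (x, y) = h (u, p) := by
  -- the strand of color `u` is continued backwards, passing under `z` with the color `a` before;
  -- slid to the other side of the singular crossing it passes under `x`, and ends in a curl at `y`
  obtain ⟨a', hfix⟩ := hS.biquandle.exists_fixed_left y
  obtain ⟨a, x', hax⟩ := hS.nondegenerateS.exists_left x a'
  obtain ⟨b, z', w', Q⟩ := UnderCube.of_front_top (κ := CrossingKind.sing) hS ht hax hfix
  obtain ⟨rfl, rfl⟩ := hS.nondegenerateS.left_unique hc Q.bottom_right
  obtain ⟨p', q', V⟩ := VerticalTwist.of_above_sing' hS hax Q.back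
  -- the second slide takes a strand that starts with a curl at `q'` over the singular crossing
  obtain ⟨q, hfix'⟩ := hS.biquandle.exists_fixed_right q'
  obtain ⟨c, p, hxq⟩ := exists_bottom S x q
  obtain ⟨v', u', hac⟩ := exists_bottom S a c
  obtain ⟨a₁, z₁, w₁, R⟩ := OverCube.of_front_top (κ := CrossingKind.sing) hS V.sing hxq hac
  obtain ⟨rfl, rfl⟩ := Prod.mk.inj (hfix'.symm.trans R.bottom_right)
  obtain ⟨rfl, rfl⟩ := Prod.mk.inj (V.below.symm.trans R.bottom_left)
  obtain ⟨rfl, rfl⟩ := hS.nondegenerateS.right_unique hac Q.bottom_left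
  refine ⟨p, q, ⟨ht, hc, R.back, hxq⟩, fun {H} _ {f h} hfh => ?_⟩
  have e1 := Q.weight_strand hfh
  have e2 := Q.weight_crossing hfh Strand.ltr
  have e3 := V.weight_ltr hfh
  have e4 := R.weight_ltr hfh
  simp only [CrossingKind.weight, hfh.f3 _ _ hfix, hfh.f3 _ _ hfix', mul_one] at e1 e2 e4
  have : f (a, c) * (f (u', w) * h (x, y)) = f (a, c) * h (u', p) := by
    rw [← mul_assoc, ← e1, e4, e3, e2]
  exact mul_left_cancel this

theorem of_sing_cross (hS : IsSingularPair S τ) {x y z w u v : X} (ht : τ (x, y) = (z, w))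
    (hc : S (u, w) = (v, y)) : ∃ p q, RightTwist S τ x y z w u v p q :=
  let ⟨p, q, Q, _⟩ := of_sing_cross_aux.{_, 0} hS ht hc
  ⟨p, q, Q⟩

theorem of_sing_cross' (hS : IsSingularPair S τ) {x y z w p q : X} (ht : τ (x, y) = (z, w))
    (hc : S (x, q) = (z, p)) : ∃ u v, RightTwist S τ x y z w u v p q := by
  obtain ⟨u, v, hc'⟩ := hS.nondegenerateS.exists_left w y
  obtain ⟨p', q', Q⟩ := of_sing_cross hS ht hc'
  obtain ⟨rfl, rfl⟩ := hS.nondegenerateS.right_unique hc Q.cross'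
  exact ⟨u, v, Q⟩

theorem weight_cross [Group H] {f h : X × X → H} {x y z w u v p q : X} (hS : IsSingularPair S τ)
    (hfh : IsNonCommCocyclePair S τ f h) (Q : RightTwist S τ x y z w u v p q) :
    f (u, w) * h (x, y) = h (u, p) := by
  obtain ⟨p', q', Q', hQ'⟩ := of_sing_cross_aux hS Q.sing Q.cross
  obtain ⟨rfl, rfl⟩ := hS.nondegenerateS.right_unique Q.cross' Q'.cross'
  exact hQ' hfh

end RightTwist

namespace LeftTwist

theorem symm {x y z w t r p q : X} (Q : LeftTwist S τ x y z w t r p q) :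
    LeftTwist S τ p t q r y w x z :=
  ⟨Q.sing', Q.cross', Q.sing, Q.cross⟩

/-- The argument is the mirror image of `RightTwist.of_sing_cross_aux`, with the two slides
exchanged. -/
theorem of_sing_cross_aux (hS : IsSingularPair S τ) {x y z w t r : X} (ht : τ (x, y) = (z, w))
    (hc : S (z, t) = (x, r)) :
    ∃ p q, LeftTwist S τ x y z w t r p q ∧
      ∀ {H : Type*} [Group H] {f h : X × X → H}, IsNonCommCocyclePair S τ f h →
        h (x, y) * f (z, t) = h (p, t) := by
  -- the strand of color `t` is continued backwards over `w`; slid to the other side of the singular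
  -- crossing it passes over `y`, and ends in a curl at `x`
  obtain ⟨c, hfix⟩ := hS.biquandle.exists_fixed_right x
  obtain ⟨e, y', hye⟩ := hS.nondegenerateS.exists_right y c
  obtain ⟨a, z', w', Q⟩ := OverCube.of_front_top (κ := CrossingKind.sing) hS ht hye hfix
  obtain ⟨rfl, rfl⟩ := hS.nondegenerateS.right_unique hc Q.bottom_left
  obtain ⟨r₁, w₁, V⟩ := VerticalTwist.of_above_sing' hS hye Q.back
  -- the second slide takes a strand that starts with a curl at `r₁` under the singular crossing
  obtain ⟨q, hfix'⟩ := hS.biquandle.exists_fixed_left r₁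
  obtain ⟨p, c', hqy⟩ := exists_bottom S q y
  obtain ⟨e', g, hce⟩ := exists_bottom S c' e
  obtain ⟨b, z₂, w₂, R⟩ := UnderCube.of_front_top (κ := CrossingKind.sing) hS V.sing hqy hce
  obtain ⟨rfl, rfl⟩ := Prod.mk.inj (hfix'.symm.trans R.bottom_left)
  obtain ⟨rfl, rfl⟩ := Prod.mk.inj (V.below.symm.trans R.bottom_right)
  obtain ⟨rfl, rfl⟩ := hS.nondegenerateS.left_unique hce Q.bottom_right
  refine ⟨p, q, ⟨ht, hc, R.back, hqy⟩, fun {H} _ {f h} hfh => ?_⟩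
  have e1 := R.weight_crossing hfh Strand.ltr
  have e2 := V.weight_ltr hfh
  have e3 := Q.weight_rtl hfh
  simp only [CrossingKind.weight] at e1 e3
  rw [← e3, e1, e2]

theorem of_sing_cross (hS : IsSingularPair S τ) {x y z w t r : X} (ht : τ (x, y) = (z, w))
    (hc : S (z, t) = (x, r)) : ∃ p q, LeftTwist S τ x y z w t r p q :=
  let ⟨p, q, Q, _⟩ := of_sing_cross_aux.{_, 0} hS ht hc
  ⟨p, q, Q⟩

theorem of_sing_cross' (hS : IsSingularPair S τ) {x y z w p q : X} (ht : τ (x, y) = (z, w))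
    (hc : S (q, y) = (p, w)) : ∃ t r, LeftTwist S τ x y z w t r p q := by
  obtain ⟨t, r, hc'⟩ := hS.nondegenerateS.exists_right z x
  obtain ⟨p', q', Q⟩ := of_sing_cross hS ht hc'
  obtain ⟨rfl, rfl⟩ := hS.nondegenerateS.left_unique hc Q.cross'
  exact ⟨t, r, Q⟩

theorem weight_cross [Group H] {f h : X × X → H} {x y z w t r p q : X} (hS : IsSingularPair S τ)
    (hfh : IsNonCommCocyclePair S τ f h) (Q : LeftTwist S τ x y z w t r p q) :
    h (x, y) * f (z, t) = h (p, t) := by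
  obtain ⟨p', q', Q', hQ'⟩ := of_sing_cross_aux hS Q.sing Q.cross
  obtain ⟨rfl, rfl⟩ := hS.nondegenerateS.left_unique Q.cross' Q'.cross'
  exact hQ' hfh

end LeftTwist

end Twist

/-! ### Colorings and products for tangles made of strands -/

section StrandTangle

variable {X H : Type*} {m n : ℕ} {K : Type}

/-- The colors of the (left, right) semi-arcs above a crossing of a tangle made of strands. -/
def strandColorsIn (pass : K × Strand → Fin m × Fin n) (C : Fin m × Fin (n + 1) → X) (c : K) :
    X × X :=
  (C ((pass (c, Strand.ltr)).1, (pass (c, Strand.ltr)).2.castSucc),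
    C ((pass (c, Strand.rtl)).1, (pass (c, Strand.rtl)).2.castSucc))

/-- The colors of the (left, right) semi-arcs below a crossing of a tangle made of strands. -/
def strandColorsOut (pass : K × Strand → Fin m × Fin n) (C : Fin m × Fin (n + 1) → X) (c : K) :
    X × X :=
  (C ((pass (c, Strand.rtl)).1, (pass (c, Strand.rtl)).2.succ),
    C ((pass (c, Strand.ltr)).1, (pass (c, Strand.ltr)).2.succ))

/-- The colorings of a tangle made of strands. -/
def IsStrandColoring (S τ : X × X → X × X) (kind : K → CrossingKind)
    (pass : K × Strand → Fin m × Fin n) (C : Fin m × Fin (n + 1) → X) : Prop :=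
  ∀ c, (kind c).Rule S τ (strandColorsIn pass C c) (strandColorsOut pass C c)

/-- The contribution of a passage in a tangle made of strands. -/
def strandWeight [Group H] (kind : K → CrossingKind) (pass : K × Strand → Fin m × Fin n)
    (f h : X × X → H) (C : Fin m × Fin (n + 1) → X) (p : K × Strand) : H :=
  (kind p.1).weight f h p.2 (strandColorsIn pass C p.1) (strandColorsOut pass C p.1)

/-- The ordered product of the weights met along the `k`-th strand of a tangle made of strands. -/
noncomputable def strandProduct [Group H] (kind : K → CrossingKind)
    (pass : K × Strand → Fin m × Fin n) (hpass : Function.Bijective pass) (f h : X × X → H)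
    (C : Fin m × Fin (n + 1) → X) (k : Fin m) : H :=
  (List.ofFn fun j =>
    strandWeight kind pass f h C ((Equiv.ofBijective pass hpass).symm (k, j))).prod

theorem strandProduct_zero [Group H] (kind : K → CrossingKind)
    (pass : K × Strand → Fin m × Fin 0) (hpass : Function.Bijective pass) (f h : X × X → H)
    (C : Fin m × Fin 1 → X) (k : Fin m) : strandProduct kind pass hpass f h C k = 1 := by
  simp [strandProduct]

theorem strandProduct_two [Group H] (kind : K → CrossingKind) {pass : K × Strand → Fin m × Fin 2}
    (hpass : Function.Bijective pass) (f h : X × X → H) (C : Fin m × Fin 3 → X) {k : Fin m}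
    {p q : K × Strand} (hp : pass p = (k, 0)) (hq : pass q = (k, 1)) :
    strandProduct kind pass hpass f h C k =
      strandWeight kind pass f h C p * strandWeight kind pass f h C q := by
  have hp' : (Equiv.ofBijective pass hpass).symm (k, 0) = p :=
    (Equiv.symm_apply_eq _).2 hp.symm
  have hq' : (Equiv.ofBijective pass hpass).symm (k, 1) = q :=
    (Equiv.symm_apply_eq _).2 hq.symm
  simp [strandProduct, List.ofFn_succ, hp', hq']

/-- Each coloring of the first tangle of strands has a partner among the colorings of the second one
with the same colors at the boundary and the same product along each strand. -/
def ColoringsMatch [Group H] (S τ : X × X → X × X) (f h : X × X → H) {n' : ℕ} {K' : Type}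
    (kind : K → CrossingKind) (pass : K × Strand → Fin m × Fin n)
    (hpass : Function.Bijective pass) (kind' : K' → CrossingKind)
    (pass' : K' × Strand → Fin m × Fin n') (hpass' : Function.Bijective pass') : Prop :=
  ∀ C : Fin m × Fin (n + 1) → X, IsStrandColoring S τ kind pass C →
    ∃ C' : Fin m × Fin (n' + 1) → X, IsStrandColoring S τ kind' pass' C' ∧
      (∀ k, C' (k, 0) = C (k, 0)) ∧ (∀ k, C' (k, Fin.last n') = C (k, Fin.last n)) ∧
      ∀ k, strandProduct kind' pass' hpass' f h C' k = strandProduct kind pass hpass f h C k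

/-- A coloring of a tangle of strands is determined by the colors at the boundary. -/
def DeterminedByBoundary (S τ : X × X → X × X) (kind : K → CrossingKind)
    (pass : K × Strand → Fin m × Fin n) : Prop :=
  ∀ C C' : Fin m × Fin (n + 1) → X, IsStrandColoring S τ kind pass C →
    IsStrandColoring S τ kind pass C' → (∀ k, C (k, 0) = C' (k, 0)) →
    (∀ k, C (k, Fin.last n) = C' (k, Fin.last n)) → C = C'

theorem determinedByBoundary_zero (S τ : X × X → X × X) (kind : K → CrossingKind)
    (pass : K × Strand → Fin m × Fin 0) : DeterminedByBoundary S τ kind pass := by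
  rintro C C' - - h0 -
  funext ⟨k, j⟩
  rw [Fin.eq_zero j]
  exact h0 k

/-- If each strand has two passages, then each strand through a crossing has one end on the boundary
and one in the interior. The two boundary ends at a crossing are adjacent, so that they determine
the interior ones. -/
theorem determinedByBoundary_two {S τ : X × X → X × X} (hS : IsSingularPair S τ)
    (kind : K → CrossingKind) (pass : K × Strand → Fin m × Fin 2)
    (hpass : Function.Surjective pass) : DeterminedByBoundary S τ kind pass := by
  intro C C' hC hC' h0 h2
  have key : ∀ c s, C ((pass (c, s)).1, 1) = C' ((pass (c, s)).1, 1) := by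
    intro c
    have e := hC c
    have e' := hC' c
    simp only [strandColorsIn, strandColorsOut] at e e'
    obtain ⟨⟨k, j⟩, hl⟩ : ∃ q, pass (c, Strand.ltr) = q := ⟨_, rfl⟩
    obtain ⟨⟨l, i⟩, hr⟩ : ∃ q, pass (c, Strand.rtl) = q := ⟨_, rfl⟩
    suffices C (k, 1) = C' (k, 1) ∧ C (l, 1) = C' (l, 1) by
      rintro (_ | _)
      · rw [hl]; exact this.1
      · rw [hr]; exact this.2
    rw [hl, hr] at e e'
    have k0 := h0 k
    have l0 := h0 l
    have k2 : C (k, 2) = C' (k, 2) := h2 k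
    have l2 : C (l, 2) = C' (l, 2) := h2 l
    match j, i with
    | 0, 0 =>
      change (kind c).Rule S τ (C (k, 0), C (l, 0)) (C (l, 1), C (k, 1)) at e
      change (kind c).Rule S τ (C' (k, 0), C' (l, 0)) (C' (l, 1), C' (k, 1)) at e'
      rw [k0, l0] at e
      exact (hS.rule_bottom_unique e e').symm
    | 0, 1 =>
      change (kind c).Rule S τ (C (k, 0), C (l, 1)) (C (l, 2), C (k, 1)) at e
      change (kind c).Rule S τ (C' (k, 0), C' (l, 1)) (C' (l, 2), C' (k, 1)) at e'
      rw [k0, l2] at e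
      exact (hS.rule_right_unique e e').symm
    | 1, 0 =>
      change (kind c).Rule S τ (C (k, 1), C (l, 0)) (C (l, 1), C (k, 2)) at e
      change (kind c).Rule S τ (C' (k, 1), C' (l, 0)) (C' (l, 1), C' (k, 2)) at e'
      rw [k2, l0] at e
      exact hS.rule_left_unique e e'
    | 1, 1 =>
      change (kind c).Rule S τ (C (k, 1), C (l, 1)) (C (l, 2), C (k, 2)) at e
      change (kind c).Rule S τ (C' (k, 1), C' (l, 1)) (C' (l, 2), C' (k, 2)) at e'
      rw [k2, l2] at e
      exact hS.rule_top_unique e e'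
  funext ⟨k, j⟩
  match j with
  | 0 => exact h0 k
  | 1 =>
    obtain ⟨⟨c, s⟩, hp⟩ := hpass (k, 0)
    have := key c s
    rwa [hp] at this
  | 2 => exact h2 k

/-- Change of the colors of the middle semi-arcs of strands with two passages. -/
def recolorMiddle (C : Fin m × Fin 3 → X) (μ : Fin m → X) : Fin m × Fin 3 → X :=
  fun a => ![C (a.1, 0), μ a.1, C (a.1, 2)] a.2

end StrandTangle

/-! ### Triangles -/

section Moves

variable {X H : Type*} [Group H] {S τ : X × X → X × X} {f h : X × X → H}

theorem inv_mul_eq_mul_inv_of_mul_eq_mul {a b c d : H} (e : a * b = c * d) :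
    a⁻¹ * c = b * d⁻¹ := by
  rw [inv_mul_eq_iff_eq_mul, ← mul_assoc, e, mul_inv_cancel_right]

theorem inv_mul_inv_eq_of_mul_eq_mul {a b c d : H} (e : a * b = c * d) :
    b⁻¹ * a⁻¹ = d⁻¹ * c⁻¹ := by
  rw [← mul_inv_rev, e, mul_inv_rev]

theorem one_mul_eq_mul_one_of_eq {a b : H} (e : a = b) : 1 * a = b * 1 := by
  rw [one_mul, mul_one, e]

/-- The passage of the line `k` of a triangle through its crossing with the lower one of the two
other lines. -/
def triangleLower (b01 b02 : Bool) : Fin 3 → StrandPair × Strand :=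
  ![(StrandPair.p01, if b01 then Strand.rtl else Strand.ltr),
    (StrandPair.p01, if b01 then Strand.ltr else Strand.rtl),
    (StrandPair.p02, if b02 then Strand.ltr else Strand.rtl)]

/-- The passage of the line `k` of a triangle through its crossing with the higher one of the two
other lines. -/
def triangleHigher (b02 b12 : Bool) : Fin 3 → StrandPair × Strand :=
  ![(StrandPair.p02, if b02 then Strand.rtl else Strand.ltr),
    (StrandPair.p12, if b12 then Strand.rtl else Strand.ltr),
    (StrandPair.p12, if b12 then Strand.ltr else Strand.rtl)]

theorem strandProduct_triangle (b01 b02 b12 d : Bool) (kind : StrandPair → CrossingKind)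
    (hp : Function.Bijective (trianglePass b01 b02 b12 d)) (C : Fin 3 × Fin 3 → X) (k : Fin 3) :
    strandProduct kind _ hp f h C k =
      if ![(b01 ^^ b02) ^^ d, (b01 ^^ b12) ^^ d, (b02 ^^ b12) ^^ d] k then
        strandWeight kind (trianglePass b01 b02 b12 d) f h C (triangleLower b01 b02 k) *
          strandWeight kind (trianglePass b01 b02 b12 d) f h C (triangleHigher b02 b12 k)
      else
        strandWeight kind (trianglePass b01 b02 b12 d) f h C (triangleHigher b02 b12 k) *
          strandWeight kind (trianglePass b01 b02 b12 d) f h C (triangleLower b01 b02 k) := by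
  cases b01 <;> cases b02 <;> cases b12 <;> cases d <;> fin_cases k <;>
    exact strandProduct_two _ _ _ _ _ rfl rfl

/-- The strand `0` slides over the crossing of `1` and `2`, whatever the kind of that crossing. The
three crossings of a triangle are three faces of an `OverCube` that meet in a vertex, those of the
other triangle are the remaining three faces; the orientations decide which vertex it is. -/
theorem coloringsMatch_triangle_over (hS : IsSingularPair S τ)
    (hfh : IsNonCommCocyclePair S τ f h) (b01 b02 b12 d : Bool) (κ : CrossingKind)
    (hp : Function.Bijective (trianglePass b01 b02 b12 d))
    (hp' : Function.Bijective (trianglePass b01 b02 b12 (!d))) :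
    ColoringsMatch S τ f h
      (StrandPair.pick (CrossingKind.ofSign b01) (CrossingKind.ofSign b02) κ)
      (trianglePass b01 b02 b12 d) hp
      (StrandPair.pick (CrossingKind.ofSign b01) (CrossingKind.ofSign b02) κ)
      (trianglePass b01 b02 b12 (!d)) hp' := by
  intro C hC
  have h01 := hC StrandPair.p01
  have h02 := hC StrandPair.p02
  have h12 := hC StrandPair.p12
  suffices ∃ μ : Fin 3 → X,
      IsStrandColoring S τ (StrandPair.pick (CrossingKind.ofSign b01) (CrossingKind.ofSign b02) κ)
        (trianglePass b01 b02 b12 (!d)) (recolorMiddle C μ) ∧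
      ∀ k, strandProduct _ _ hp' f h (recolorMiddle C μ) k = strandProduct _ _ hp f h C k by
    obtain ⟨μ, h1, h2⟩ := this
    exact ⟨recolorMiddle C μ, h1, fun _ => rfl, fun _ => rfl, h2⟩
  cases b12 <;> cases b01 <;> cases b02 <;> cases d
  all_goals
    simp [CrossingKind.ofSign, CrossingKind.rule_pos, CrossingKind.rule_neg, trianglePass,
      strandColorsIn, strandColorsOut, StrandPair.pick, StrandPair.fst, StrandPair.snd]
      at h01 h02 h12
    -- one alternative for each vertex of the cube, first with `2` and then with `1` as the strand
    -- `ltr` of the crossing of `1` and `2`; `s, μ1, μ2` are the new colors on `0, 1, 2`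
    first
    | have Q := OverCube.of_front_top hS h12 h01 h02
      obtain ⟨s, μ1, μ2, Q⟩ := Q
    | have Q := OverCube.of_front_right hS h12 h01 h02
      obtain ⟨s, μ2, μ1, Q⟩ := Q
    | have Q := OverCube.of_front_bottom hS h12 h02 h01
      obtain ⟨s, μ2, μ1, Q⟩ := Q
    | have Q := OverCube.of_front_left hS h12 h02 h01
      obtain ⟨s, μ1, μ2, Q⟩ := Q
    | have Q := OverCube.of_back_top hS h12 h01 h02
      obtain ⟨s, μ1, μ2, Q⟩ := Q
    | have Q := OverCube.of_back_left hS h12 h02 h01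
      obtain ⟨s, μ1, μ2, Q⟩ := Q
    | have Q := OverCube.of_back_right hS h12 h01 h02
      obtain ⟨s, μ2, μ1, Q⟩ := Q
    | have Q := OverCube.of_back_bottom hS h12 h02 h01
      obtain ⟨s, μ2, μ1, Q⟩ := Q
    | have Q := OverCube.of_front_top hS h12 h02 h01
      obtain ⟨s, μ2, μ1, Q⟩ := Q
    | have Q := OverCube.of_front_right hS h12 h02 h01
      obtain ⟨s, μ1, μ2, Q⟩ := Q
    | have Q := OverCube.of_front_bottom hS h12 h01 h02
      obtain ⟨s, μ1, μ2, Q⟩ := Q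
    | have Q := OverCube.of_front_left hS h12 h01 h02
      obtain ⟨s, μ2, μ1, Q⟩ := Q
    | have Q := OverCube.of_back_top hS h12 h02 h01
      obtain ⟨s, μ2, μ1, Q⟩ := Q
    | have Q := OverCube.of_back_left hS h12 h01 h02
      obtain ⟨s, μ2, μ1, Q⟩ := Q
    | have Q := OverCube.of_back_right hS h12 h02 h01
      obtain ⟨s, μ1, μ2, Q⟩ := Q
    | have Q := OverCube.of_back_bottom hS h12 h01 h02
      obtain ⟨s, μ1, μ2, Q⟩ := Q
  all_goals
    refine ⟨![s, μ1, μ2], ?_, fun k => ?_⟩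
    · rintro (_ | _ | _)
      on_goal 3 => first | exact Q.front | exact Q.back
      all_goals
        first
        | exact Q.top_left
        | exact Q.top_right
        | exact Q.bottom_left
        | exact Q.bottom_right
    · have wl := Q.weight_ltr hfh
      have wr := Q.weight_rtl hfh
      rw [strandProduct_triangle, strandProduct_triangle]
      fin_cases k
      · rfl
      all_goals
        first
        | exact wl
        | exact wr
        | exact wl.symm
        | exact wr.symm
        | exact inv_mul_eq_mul_inv_of_mul_eq_mul wl
        | exact inv_mul_eq_mul_inv_of_mul_eq_mul wr
        | exact (inv_mul_eq_mul_inv_of_mul_eq_mul wl).symm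
        | exact (inv_mul_eq_mul_inv_of_mul_eq_mul wr).symm

/-- The strand `0` slides under the crossing of `1` and `2`, whatever the kind of that crossing. -/
theorem coloringsMatch_triangle_under (hS : IsSingularPair S τ)
    (hfh : IsNonCommCocyclePair S τ f h) (b01 b02 b12 d : Bool) (κ : CrossingKind)
    (hp : Function.Bijective (trianglePass b01 b02 b12 d))
    (hp' : Function.Bijective (trianglePass b01 b02 b12 (!d))) :
    ColoringsMatch S τ f h
      (StrandPair.pick (CrossingKind.ofSign !b01) (CrossingKind.ofSign !b02) κ)
      (trianglePass b01 b02 b12 d) hp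
      (StrandPair.pick (CrossingKind.ofSign !b01) (CrossingKind.ofSign !b02) κ)
      (trianglePass b01 b02 b12 (!d)) hp' := by
  intro C hC
  have h01 := hC StrandPair.p01
  have h02 := hC StrandPair.p02
  have h12 := hC StrandPair.p12
  suffices ∃ μ : Fin 3 → X,
      IsStrandColoring S τ (StrandPair.pick (CrossingKind.ofSign !b01) (CrossingKind.ofSign !b02) κ)
        (trianglePass b01 b02 b12 (!d)) (recolorMiddle C μ) ∧
      ∀ k, strandProduct _ _ hp' f h (recolorMiddle C μ) k = strandProduct _ _ hp f h C k by
    obtain ⟨μ, h1, h2⟩ := this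
    exact ⟨recolorMiddle C μ, h1, fun _ => rfl, fun _ => rfl, h2⟩
  cases b12 <;> cases b01 <;> cases b02 <;> cases d
  all_goals
    simp [CrossingKind.ofSign, CrossingKind.rule_pos, CrossingKind.rule_neg, trianglePass,
      strandColorsIn, strandColorsOut, StrandPair.pick, StrandPair.fst, StrandPair.snd]
      at h01 h02 h12
    -- one alternative for each vertex of the cube, first with `2` and then with `1` as the strand
    -- `ltr` of the crossing of `1` and `2`; `s, μ1, μ2` are the new colors on `0, 1, 2`
    first
    | have Q := UnderCube.of_front_top hS h12 h02 h01
      obtain ⟨s, μ1, μ2, Q⟩ := Q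
    | have Q := UnderCube.of_front_left hS h12 h02 h01
      obtain ⟨s, μ1, μ2, Q⟩ := Q
    | have Q := UnderCube.of_front_bottom hS h12 h01 h02
      obtain ⟨s, μ2, μ1, Q⟩ := Q
    | have Q := UnderCube.of_front_right hS h12 h01 h02
      obtain ⟨s, μ2, μ1, Q⟩ := Q
    | have Q := UnderCube.of_back_top hS h12 h02 h01
      obtain ⟨s, μ1, μ2, Q⟩ := Q
    | have Q := UnderCube.of_back_left hS h12 h02 h01
      obtain ⟨s, μ1, μ2, Q⟩ := Q
    | have Q := UnderCube.of_back_right hS h12 h01 h02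
      obtain ⟨s, μ2, μ1, Q⟩ := Q
    | have Q := UnderCube.of_back_bottom hS h12 h01 h02
      obtain ⟨s, μ2, μ1, Q⟩ := Q
    | have Q := UnderCube.of_front_top hS h12 h01 h02
      obtain ⟨s, μ2, μ1, Q⟩ := Q
    | have Q := UnderCube.of_front_left hS h12 h01 h02
      obtain ⟨s, μ2, μ1, Q⟩ := Q
    | have Q := UnderCube.of_front_bottom hS h12 h02 h01
      obtain ⟨s, μ1, μ2, Q⟩ := Q
    | have Q := UnderCube.of_front_right hS h12 h02 h01
      obtain ⟨s, μ1, μ2, Q⟩ := Q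
    | have Q := UnderCube.of_back_top hS h12 h01 h02
      obtain ⟨s, μ2, μ1, Q⟩ := Q
    | have Q := UnderCube.of_back_left hS h12 h01 h02
      obtain ⟨s, μ2, μ1, Q⟩ := Q
    | have Q := UnderCube.of_back_right hS h12 h02 h01
      obtain ⟨s, μ1, μ2, Q⟩ := Q
    | have Q := UnderCube.of_back_bottom hS h12 h02 h01
      obtain ⟨s, μ1, μ2, Q⟩ := Q
  all_goals
    refine ⟨![s, μ1, μ2], ?_, fun k => ?_⟩
    · rintro (_ | _ | _)
      on_goal 3 => first | exact Q.front | exact Q.back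
      all_goals
        first
        | exact Q.top_left
        | exact Q.top_right
        | exact Q.bottom_left
        | exact Q.bottom_right
    · have ws := Q.weight_strand hfh
      have wc := Q.weight_crossing hfh
      rw [strandProduct_triangle, strandProduct_triangle]
      fin_cases k
      · first
        | exact ws
        | exact ws.symm
        | exact inv_mul_inv_eq_of_mul_eq_mul ws
        | exact (inv_mul_inv_eq_of_mul_eq_mul ws).symm
        | exact inv_mul_eq_mul_inv_of_mul_eq_mul ws
        | exact (inv_mul_eq_mul_inv_of_mul_eq_mul ws).symm
        | exact inv_mul_eq_mul_inv_of_mul_eq_mul ws.symm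
        | exact (inv_mul_eq_mul_inv_of_mul_eq_mul ws.symm).symm
      all_goals
        first
        | exact one_mul_eq_mul_one_of_eq (wc _)
        | exact one_mul_eq_mul_one_of_eq (wc _).symm
        | exact (one_mul_eq_mul_one_of_eq (wc _)).symm
        | exact (one_mul_eq_mul_one_of_eq (wc _).symm).symm

end Moves

/-! ### Curls, bigons and twists -/

section Moves

variable {X H : Type*} [Group H] {S τ : X × X → X × X} {f h : X × X → H}

theorem coloringsMatch_plain_curl (hS : IsSingularPair S τ) (hfh : IsNonCommCocyclePair S τ f h)
    {K : Type} (kind : K → CrossingKind) (pass : K × Strand → Fin 1 × Fin 0)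
    (hp : Function.Bijective pass) (positive left : Bool)
    (hp' : Function.Bijective (curlPass left)) :
    ColoringsMatch S τ f h kind pass hp (fun _ : Unit => CrossingKind.ofSign positive)
      (curlPass left) hp' := by
  intro C _
  suffices ∃ y, IsStrandColoring S τ (fun _ : Unit => CrossingKind.ofSign positive)
      (curlPass left) (fun a => ![C (0, 0), y, C (0, 0)] a.2) ∧
      strandProduct (fun _ : Unit => CrossingKind.ofSign positive) (curlPass left) hp' f h
        (fun a => ![C (0, 0), y, C (0, 0)] a.2) 0 = 1 by
    obtain ⟨y, h1, h2⟩ := this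
    refine ⟨_, h1, fun k => ?_, fun k => ?_, fun k => ?_⟩ <;> rw [Fin.eq_zero k]
    · rfl
    · rfl
    · rw [h2, strandProduct_zero]
  cases left
  · obtain ⟨y, hy⟩ := hS.biquandle.exists_fixed_right (C (0, 0))
    have hf := hfh.f3 _ _ hy
    refine ⟨y, fun _ => by cases positive <;> exact hy, ?_⟩
    rw [strandProduct_two (p := ((), Strand.ltr)) (q := ((), Strand.rtl)) _ hp' f h _ rfl rfl]
    cases positive
    · exact (one_mul _).trans (inv_eq_one.2 hf)
    · exact (mul_one _).trans hf
  · obtain ⟨y, hy⟩ := hS.biquandle.exists_fixed_left (C (0, 0))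
    have hf := hfh.f3 _ _ hy
    refine ⟨y, fun _ => by cases positive <;> exact hy, ?_⟩
    rw [strandProduct_two (p := ((), Strand.rtl)) (q := ((), Strand.ltr)) _ hp' f h _ rfl rfl]
    cases positive
    · exact (mul_one _).trans (inv_eq_one.2 hf)
    · exact (one_mul _).trans hf

theorem coloringsMatch_curl_plain (hS : IsSingularPair S τ) (hfh : IsNonCommCocyclePair S τ f h)
    {K : Type} [IsEmpty K] (kind : K → CrossingKind) (pass : K × Strand → Fin 1 × Fin 0)
    (hp : Function.Bijective pass) (positive left : Bool)
    (hp' : Function.Bijective (curlPass left)) :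
    ColoringsMatch S τ f h (fun _ : Unit => CrossingKind.ofSign positive) (curlPass left) hp'
      kind pass hp := by
  intro C hC
  have e := hC ()
  suffices C (0, 2) = C (0, 0) ∧
      strandProduct (fun _ : Unit => CrossingKind.ofSign positive) (curlPass left) hp' f h C 0 =
        1 by
    refine ⟨fun a => C (0, 0), isEmptyElim, fun k => ?_, fun k => ?_, fun k => ?_⟩ <;>
      rw [Fin.eq_zero k]
    · exact this.1.symm
    · rw [this.2, strandProduct_zero]
  cases left
  · rw [strandProduct_two (p := ((), Strand.ltr)) (q := ((), Strand.rtl)) _ hp' f h _ rfl rfl]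
    cases positive
    · change S (C (0, 2), C (0, 1)) = (C (0, 0), C (0, 1)) at e
      have e' := hS.biquandle.left_eq_of_right_eq e
      rw [e'] at e
      exact ⟨e'.symm, (one_mul _).trans (inv_eq_one.2 (hfh.f3 _ _ e))⟩
    · change S (C (0, 0), C (0, 1)) = (C (0, 2), C (0, 1)) at e
      have e' := hS.biquandle.left_eq_of_right_eq e
      rw [e'] at e
      exact ⟨e', (mul_one _).trans (hfh.f3 _ _ e)⟩
  · rw [strandProduct_two (p := ((), Strand.rtl)) (q := ((), Strand.ltr)) _ hp' f h _ rfl rfl]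
    cases positive
    · change S (C (0, 1), C (0, 2)) = (C (0, 1), C (0, 0)) at e
      have e' := hS.biquandle.right_eq_of_left_eq e
      rw [e'] at e
      exact ⟨e'.symm, (mul_one _).trans (inv_eq_one.2 (hfh.f3 _ _ e))⟩
    · change S (C (0, 1), C (0, 0)) = (C (0, 1), C (0, 2)) at e
      have e' := hS.biquandle.right_eq_of_left_eq e
      rw [e'] at e
      exact ⟨e', (one_mul _).trans (hfh.f3 _ _ e)⟩

theorem strandProduct_bigon_zero (positive parallel : Bool)
    (hp : Function.Bijective (bigonPass positive parallel)) (C : Fin 2 × Fin 3 → X) :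
    strandProduct (fun c : Fin 2 => CrossingKind.ofSign (if c = 0 then positive else !positive))
      _ hp f h C 0 = 1 := by
  rw [strandProduct_two (p := (0, if positive then Strand.rtl else Strand.ltr))
    (q := (1, if positive then Strand.ltr else Strand.rtl)) _ hp f h _
    (by cases positive <;> cases parallel <;> rfl) (by cases positive <;> cases parallel <;> rfl)]
  cases positive <;> exact one_mul _

theorem strandProduct_bigon_one (positive parallel : Bool)
    (hp : Function.Bijective (bigonPass positive parallel)) (C : Fin 2 × Fin 3 → X)
    (h0 : C (0, 2) = C (0, 0)) (h1 : C (1, 2) = C (1, 0)) :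
    strandProduct (fun c : Fin 2 => CrossingKind.ofSign (if c = 0 then positive else !positive))
      _ hp f h C 1 = 1 := by
  cases parallel
  · rw [strandProduct_two (p := (1, if positive then Strand.rtl else Strand.ltr))
      (q := (0, if positive then Strand.ltr else Strand.rtl)) _ hp f h _
      (by cases positive <;> rfl) (by cases positive <;> rfl)]
    cases positive
    · change f (C (1, 0), C (0, 1)) * (f (C (1, 2), C (0, 1)))⁻¹ = 1
      rw [h1, mul_inv_cancel]
    · change (f (C (1, 1), C (0, 2)))⁻¹ * f (C (1, 1), C (0, 0)) = 1
      rw [h0, inv_mul_cancel]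
  · rw [strandProduct_two (p := (0, if positive then Strand.ltr else Strand.rtl))
      (q := (1, if positive then Strand.rtl else Strand.ltr)) _ hp f h _
      (by cases positive <;> rfl) (by cases positive <;> rfl)]
    cases positive
    · change (f (C (1, 1), C (0, 1)))⁻¹ * f (C (1, 1), C (0, 1)) = 1
      rw [inv_mul_cancel]
    · change f (C (1, 0), C (0, 0)) * (f (C (1, 2), C (0, 2)))⁻¹ = 1
      rw [h0, h1, mul_inv_cancel]

theorem coloringsMatch_plain_bigon (hS : IsSingularPair S τ) {K : Type} (kind : K → CrossingKind)
    (pass : K × Strand → Fin 2 × Fin 0) (hp : Function.Bijective pass) (positive parallel : Bool)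
    (hp' : Function.Bijective (bigonPass positive parallel)) :
    ColoringsMatch S τ f h kind pass hp
      (fun c : Fin 2 => CrossingKind.ofSign (if c = 0 then positive else !positive))
      (bigonPass positive parallel) hp' := by
  intro C _
  suffices ∃ o u, IsStrandColoring S τ
      (fun c : Fin 2 => CrossingKind.ofSign (if c = 0 then positive else !positive))
      (bigonPass positive parallel)
      (fun a => ![C (a.1, 0), ![o, u] a.1, C (a.1, 0)] a.2) by
    obtain ⟨o, u, h1⟩ := this
    refine ⟨_, h1, fun k => rfl, fun k => rfl, fun k => ?_⟩
    rw [strandProduct_zero]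
    fin_cases k
    · exact strandProduct_bigon_zero positive parallel hp' _
    · exact strandProduct_bigon_one positive parallel hp' _ rfl rfl
  cases parallel <;> cases positive
  · obtain ⟨o, u, e⟩ := hS.nondegenerateS.exists_right (C (1, 0)) (C (0, 0))
    exact ⟨o, u, fun c => by fin_cases c <;> exact e⟩
  · obtain ⟨u, o, e⟩ := hS.nondegenerateS.exists_left (C (0, 0)) (C (1, 0))
    exact ⟨o, u, fun c => by fin_cases c <;> exact e⟩
  · obtain ⟨u, o, e⟩ := hS.nondegenerateS.exists_top (C (0, 0)) (C (1, 0))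
    exact ⟨o, u, fun c => by fin_cases c <;> exact e⟩
  · obtain ⟨o, u, e⟩ := exists_bottom S (C (1, 0)) (C (0, 0))
    exact ⟨o, u, fun c => by fin_cases c <;> exact e⟩

theorem coloringsMatch_bigon_plain (hS : IsSingularPair S τ) {K : Type} [IsEmpty K]
    (kind : K → CrossingKind) (pass : K × Strand → Fin 2 × Fin 0) (hp : Function.Bijective pass)
    (positive parallel : Bool) (hp' : Function.Bijective (bigonPass positive parallel)) :
    ColoringsMatch S τ f h
      (fun c : Fin 2 => CrossingKind.ofSign (if c = 0 then positive else !positive))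
      (bigonPass positive parallel) hp' kind pass hp := by
  intro C hC
  have e0 := hC 0
  have e1 := hC 1
  have key : C (0, 2) = C (0, 0) ∧ C (1, 2) = C (1, 0) := by
    cases parallel <;> cases positive
    · change S (C (1, 2), C (0, 1)) = (C (0, 0), C (1, 1)) at e0
      change S (C (1, 0), C (0, 1)) = (C (0, 2), C (1, 1)) at e1
      exact (hS.nondegenerateS.left_unique e0 e1).symm.imp Eq.symm id
    · change S (C (1, 1), C (0, 0)) = (C (0, 1), C (1, 2)) at e0
      change S (C (1, 1), C (0, 2)) = (C (0, 1), C (1, 0)) at e1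
      exact (hS.nondegenerateS.right_unique e1 e0).imp id Eq.symm
    · change S (C (1, 1), C (0, 1)) = (C (0, 0), C (1, 0)) at e0
      change S (C (1, 1), C (0, 1)) = (C (0, 2), C (1, 2)) at e1
      exact Prod.mk.inj (e1.symm.trans e0)
    · change S (C (1, 0), C (0, 0)) = (C (0, 1), C (1, 1)) at e0
      change S (C (1, 2), C (0, 2)) = (C (0, 1), C (1, 1)) at e1
      exact (hS.nondegenerateS.top_unique e1 e0).symm
  refine ⟨fun a => C (a.1, 0), isEmptyElim, fun k => rfl, fun k => ?_, fun k => ?_⟩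
  · fin_cases k
    · exact key.1.symm
    · exact key.2.symm
  · rw [strandProduct_zero]
    fin_cases k
    · exact (strandProduct_bigon_zero positive parallel hp' C).symm
    · exact (strandProduct_bigon_one positive parallel hp' C key.1 key.2).symm

/-- The passage of the strand `k` through the singular crossing next to a classical one. -/
def twistSing (ltr0 : Bool) : Fin 2 → Bool × Strand :=
  ![(true, if ltr0 then Strand.ltr else Strand.rtl),
    (true, if ltr0 then Strand.rtl else Strand.ltr)]

/-- The passage of the strand `k` through the classical crossing next to a singular one. -/
def twistClassical (ltr0 : Bool) : Fin 2 → Bool × Strand :=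
  ![(false, if ltr0 then Strand.rtl else Strand.ltr),
    (false, if ltr0 then Strand.ltr else Strand.rtl)]

theorem strandProduct_twist (ltr0 first0 first1 : Bool) (kind : Bool → CrossingKind)
    (hp : Function.Bijective (twistPass ltr0 first0 first1)) (C : Fin 2 × Fin 3 → X) (k : Fin 2) :
    strandProduct kind _ hp f h C k =
      if ![first0, first1] k then
        strandWeight kind (twistPass ltr0 first0 first1) f h C (twistSing ltr0 k) *
          strandWeight kind (twistPass ltr0 first0 first1) f h C (twistClassical ltr0 k)
      else
        strandWeight kind (twistPass ltr0 first0 first1) f h C (twistClassical ltr0 k) *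
          strandWeight kind (twistPass ltr0 first0 first1) f h C (twistSing ltr0 k) := by
  cases ltr0 <;> cases first0 <;> cases first1 <;> fin_cases k <;>
    exact strandProduct_two _ _ _ _ _ rfl rfl

theorem mul_eq_mul_one_of_mul_eq {a b c : H} (e : a * b = c) : a * b = c * 1 := by
  rw [mul_one, e]

theorem mul_eq_one_mul_of_mul_eq {a b c : H} (e : a * b = c) : a * b = 1 * c := by
  rw [one_mul, e]

theorem inv_mul_eq_mul_one_of_mul_eq {a b c : H} (e : a * b = c) : a⁻¹ * c = b * 1 := by
  rw [← e, inv_mul_cancel_left, mul_one]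

theorem mul_inv_eq_one_mul_of_mul_eq {a b c : H} (e : a * b = c) : c * b⁻¹ = 1 * a := by
  rw [← e, mul_inv_cancel_right, one_mul]

/-- If both strands meet the two crossings in the same order, then the classical crossing moves from
above to below the singular one or back; otherwise it moves between the right and the left side. -/
theorem coloringsMatch_twist (hS : IsSingularPair S τ) (hfh : IsNonCommCocyclePair S τ f h)
    (positive ltr0 first0 first1 : Bool)
    (hp : Function.Bijective (twistPass ltr0 first0 first1))
    (hp' : Function.Bijective (twistPass (!ltr0) (!first0) (!first1))) :
    ColoringsMatch S τ f h
      (fun c : Bool => if c then CrossingKind.sing else CrossingKind.ofSign positive)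
      (twistPass ltr0 first0 first1) hp
      (fun c : Bool => if c then CrossingKind.sing else CrossingKind.ofSign positive)
      (twistPass (!ltr0) (!first0) (!first1)) hp' := by
  intro C hC
  have hs := hC true
  have hc := hC false
  suffices ∃ μ : Fin 2 → X,
      IsStrandColoring S τ
        (fun c : Bool => if c then CrossingKind.sing else CrossingKind.ofSign positive)
        (twistPass (!ltr0) (!first0) (!first1)) (recolorMiddle C μ) ∧
      ∀ k, strandProduct _ _ hp' f h (recolorMiddle C μ) k = strandProduct _ _ hp f h C k by
    obtain ⟨μ, h1, h2⟩ := this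
    exact ⟨recolorMiddle C μ, h1, fun _ => rfl, fun _ => rfl, h2⟩
  -- `l` and `r` are the new colors of the strands `ltr` and `rtl` of the original singular crossing
  suffices ∃ l r : X,
      IsStrandColoring S τ
        (fun c : Bool => if c then CrossingKind.sing else CrossingKind.ofSign positive)
        (twistPass (!ltr0) (!first0) (!first1))
        (recolorMiddle C (if ltr0 then ![l, r] else ![r, l])) ∧
      ∀ k, strandProduct _ _ hp' f h (recolorMiddle C (if ltr0 then ![l, r] else ![r, l])) k =
        strandProduct _ _ hp f h C k by
    obtain ⟨l, r, h⟩ := this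
    exact ⟨_, h⟩
  cases positive <;> cases first0 <;> cases first1 <;> cases ltr0
  all_goals
    simp [CrossingKind.ofSign, CrossingKind.rule_pos, CrossingKind.rule_neg,
      CrossingKind.rule_sing, twistPass, strandColorsIn, strandColorsOut] at hs hc
    first
    | have Q := VerticalTwist.of_above_sing hS hc hs
      obtain ⟨l, r, Q⟩ := Q
      have wl := (Q.weight_ltr hfh).symm
      have wr := (Q.weight_rtl hfh).symm
    | have Q := VerticalTwist.of_above_sing' hS hc hs
      obtain ⟨l, r, Q⟩ := Q
      have wl := (Q.weight_ltr hfh).symm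
      have wr := (Q.weight_rtl hfh).symm
    | have Q := VerticalTwist.of_sing_below hS hs hc
      obtain ⟨r, l, Q⟩ := Q
      have wl := (Q.weight_ltr hfh).symm
      have wr := (Q.weight_rtl hfh).symm
    | have Q := VerticalTwist.of_sing'_below hS hs hc
      obtain ⟨r, l, Q⟩ := Q
      have wl := (Q.weight_ltr hfh).symm
      have wr := (Q.weight_rtl hfh).symm
    | have Q := RightTwist.of_sing_cross hS hs hc
      obtain ⟨l, r, Q⟩ := Q
      have wl := Q.weight_cross hS hfh
      have wr := Q.symm.weight_cross hS hfh
    | have Q := RightTwist.of_sing_cross' hS hs hc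
      obtain ⟨r, l, Q⟩ := Q
      have wl := Q.weight_cross hS hfh
      have wr := Q.symm.weight_cross hS hfh
    | have Q := LeftTwist.of_sing_cross hS hs hc
      obtain ⟨r, l, Q⟩ := Q
      have wl := Q.weight_cross hS hfh
      have wr := Q.symm.weight_cross hS hfh
    | have Q := LeftTwist.of_sing_cross' hS hs hc
      obtain ⟨l, r, Q⟩ := Q
      have wl := Q.weight_cross hS hfh
      have wr := Q.symm.weight_cross hS hfh
  -- `wl` and `wr` relate the products along the two strands
  all_goals
    refine ⟨l, r, ?_, fun k => ?_⟩
    · rintro (_ | _)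
      · first
        | exact Q.above
        | exact Q.below
        | exact Q.cross
        | exact Q.cross'
      · first
        | exact Q.sing
        | exact Q.sing'
    · rw [strandProduct_twist, strandProduct_twist]
      fin_cases k
      all_goals
        first
        | exact mul_eq_mul_one_of_mul_eq wl
        | exact mul_eq_mul_one_of_mul_eq wr
        | exact mul_eq_one_mul_of_mul_eq wl
        | exact mul_eq_one_mul_of_mul_eq wr
        | exact inv_mul_eq_mul_one_of_mul_eq wl
        | exact inv_mul_eq_mul_one_of_mul_eq wr
        | exact mul_inv_eq_one_mul_of_mul_eq wl
        | exact mul_inv_eq_one_mul_of_mul_eq wr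
        | exact (mul_eq_mul_one_of_mul_eq wl).symm
        | exact (mul_eq_mul_one_of_mul_eq wr).symm
        | exact (mul_eq_one_mul_of_mul_eq wl).symm
        | exact (mul_eq_one_mul_of_mul_eq wr).symm
        | exact (inv_mul_eq_mul_one_of_mul_eq wl).symm
        | exact (inv_mul_eq_mul_one_of_mul_eq wr).symm
        | exact (mul_inv_eq_one_mul_of_mul_eq wl).symm
        | exact (mul_inv_eq_one_mul_of_mul_eq wr).symm

end Moves

/-! ### Products along the cycles of a map -/

section CycleProduct

variable {A B H : Type*} [Group H]

/-- The ordered product of the weights met along the cycle of `a` under a map. -/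
noncomputable def cycleProduct (n : A → A) (w : A → H) (a : A) : H :=
  ((List.range (Function.minimalPeriod n a)).map fun i => w (n^[i] a)).prod

theorem cycleProduct_eq_one {n : A → A} {w : A → H} {a : A} (hw : ∀ i, w (n^[i] a) = 1) :
    cycleProduct n w a = 1 := by
  simp [cycleProduct, hw]

theorem isConj_cycleProduct_apply [Finite A] {n : A → A} (hn : Function.Injective n) (w : A → H)
    (a : A) : IsConj (cycleProduct n w a) (cycleProduct n w (n a)) := by
  have ha : a ∈ Function.periodicPts n := hn.mem_periodicPts a
  rw [isConj_iff]
  refine ⟨(w a)⁻¹, ?_⟩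
  have h1 := List.prod_range_succ (fun i => w (n^[i] a)) (Function.minimalPeriod n a)
  have h2 := List.prod_range_succ' (fun i => w (n^[i] a)) (Function.minimalPeriod n a)
  rw [Function.iterate_minimalPeriod] at h1
  unfold cycleProduct
  rw [Function.minimalPeriod_apply ha, inv_inv, mul_assoc, ← h1, h2]
  simp

/-- The product along a cycle does not change when the map is replaced by its first return map to a
subset, and the weights by their products between consecutive visits to the subset. -/
theorem cycleProduct_firstReturn [Finite A] {n : A → A} (hn : Function.Injective n) (w : A → H)
    {nB : B → B} {wB : B → H} {ι : B → A} (hι : Function.Injective ι)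
    (h : ∀ b, ∃ r, 0 < r ∧ n^[r] (ι b) = ι (nB b) ∧
      (∀ i, 0 < i → i < r → n^[i] (ι b) ∉ Set.range ι) ∧
      ((List.range r).map fun i => w (n^[i] (ι b))).prod = wB b) (b : B) :
    cycleProduct nB wB b = cycleProduct n w (ι b) := by
  choose r r_pos hr hr' hw using h
  -- `R k` is the time of the `k`-th return
  obtain ⟨R, R_zero, R_succ⟩ : ∃ R : ℕ → ℕ, R 0 = 0 ∧ ∀ k, R (k + 1) = R k + r (nB^[k] b) :=
    ⟨fun k => ∑ i ∈ Finset.range k, r (nB^[i] b), rfl, fun k => Finset.sum_range_succ _ _⟩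
  have R_mono : StrictMono R := strictMono_nat_of_lt_succ fun k => by
    rw [R_succ]
    exact Nat.lt_add_of_pos_right (r_pos _)
  have hR : ∀ k, n^[R k] (ι b) = ι (nB^[k] b) := by
    intro k
    induction k with
    | zero => rw [R_zero]; rfl
    | succ k ih =>
      rw [R_succ, Nat.add_comm, Function.iterate_add_apply, ih, hr, Function.iterate_succ_apply']
  have hprod : ∀ k, ((List.range (R k)).map fun i => w (n^[i] (ι b))).prod =
      ((List.range k).map fun i => wB (nB^[i] b)).prod := by
    intro k
    induction k with
    | zero => rw [R_zero]; rfl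
    | succ k ih =>
      rw [List.prod_range_succ, ← ih, ← hw, R_succ, List.range_add, List.map_append,
        List.prod_append, List.map_map]
      congr 3
      funext i
      rw [Function.comp_apply, Nat.add_comm, Function.iterate_add_apply, hR]
  have hvisit : ∀ t, n^[t] (ι b) ∈ Set.range ι → ∃ k, t = R k := by
    intro t ht
    obtain ⟨k, hk, hk'⟩ : ∃ k, R k ≤ t ∧ t < R (k + 1) := by
      have hex : ∃ k, t < R k := ⟨t + 1, R_mono.le_apply⟩
      obtain ⟨k, hk⟩ : ∃ k, Nat.find hex = k + 1 :=
        Nat.exists_eq_succ_of_ne_zero fun h0 => by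
          have := Nat.find_spec hex
          rw [h0, R_zero] at this
          exact Nat.not_lt_zero _ this
      exact ⟨k, Nat.le_of_not_lt (Nat.find_min hex (by omega)), hk ▸ Nat.find_spec hex⟩
    refine ⟨k, by_contra fun hne => hr' (nB^[k] b) (t - R k) (by omega) ?_ ?_⟩
    · rw [R_succ] at hk'
      omega
    · rwa [← hR, ← Function.iterate_add_apply, Nat.sub_add_cancel hk]
  have hper : ι b ∈ Function.periodicPts n := hn.mem_periodicPts _
  have hpos := Function.minimalPeriod_pos_of_mem_periodicPts hper
  obtain ⟨k, hk⟩ := hvisit (Function.minimalPeriod n (ι b))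
    (by rw [Function.iterate_minimalPeriod]; exact ⟨b, rfl⟩)
  have hk0 : 0 < k := by
    rcases Nat.eq_zero_or_pos k with rfl | h0
    · omega
    · exact h0
  have hbk : Function.IsPeriodicPt nB k b :=
    hι (by rw [← hR, ← hk, Function.iterate_minimalPeriod])
  have hle := hbk.minimalPeriod_le hk0
  have hBpos := hbk.minimalPeriod_pos hk0
  have hge : R k ≤ R (Function.minimalPeriod nB b) := by
    rw [← hk]
    refine Function.IsPeriodicPt.minimalPeriod_le ?_ ?_
    · have := R_mono hBpos
      omega
    · change n^[_] _ = _
      rw [hR, Function.iterate_minimalPeriod]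
  have : k = Function.minimalPeriod nB b := le_antisymm (R_mono.le_iff_le.1 hge) hle
  unfold cycleProduct
  rw [hk, hprod, ← this]

end CycleProduct

/-! ### Travelling through a tangle -/

section Follow

variable {X H : Type*} {I O : Type}

theorem Tangle.enter_injective (D : Tangle I O) : Function.Injective D.enter :=
  fun _ _ h => Sum.inl_injective (D.end_injective h)

open Classical in
/-- The place where one arrives at the end of a semi-arc, going straight through the crossing if
there is one: a semi-arc or an outgoing boundary point. -/
noncomputable def Tangle.follow (D : Tangle I O) (a : D.Arc) : D.Arc ⊕ O :=
  if hp : ∃ p, D.enter p = a then Sum.inl (D.leave hp.choose)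
  else if ho : ∃ o, D.target o = a then Sum.inr ho.choose else Sum.inl a

open Classical in
/-- The contribution of the passage at the end of a semi-arc, if there is one. -/
noncomputable def Tangle.endWeight [Group H] (D : Tangle I O) (f h : X × X → H) (C : D.Arc → X)
    (a : D.Arc) : H :=
  if hp : ∃ p, D.enter p = a then D.passageWeight f h C hp.choose else 1

theorem Tangle.follow_enter (D : Tangle I O) (p : D.Crossing × Strand) :
    D.follow (D.enter p) = Sum.inl (D.leave p) := by
  have hp : ∃ q, D.enter q = D.enter p := ⟨p, rfl⟩
  rw [Tangle.follow, dif_pos hp, D.enter_injective hp.choose_spec]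

theorem Tangle.enter_ne_target (D : Tangle I O) (p : D.Crossing × Strand) (o : O) :
    D.enter p ≠ D.target o :=
  fun h => Sum.inl_ne_inr (D.end_injective (a₁ := Sum.inl p) (a₂ := Sum.inr o) h)

theorem Tangle.follow_target (D : Tangle I O) (o : O) : D.follow (D.target o) = Sum.inr o := by
  have hp : ¬∃ q, D.enter q = D.target o := fun ⟨q, hq⟩ => D.enter_ne_target q o hq
  have ho : ∃ o', D.target o' = D.target o := ⟨o, rfl⟩
  rw [Tangle.follow, dif_neg hp, dif_pos ho,
    Sum.inr_injective (D.end_injective (a₁ := Sum.inr _) (a₂ := Sum.inr _) ho.choose_spec)]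

theorem Tangle.follow_circle (D : Tangle I O) {a : D.Arc}
    (ha : a ∉ Set.range (Sum.elim D.enter D.target)) : D.follow a = Sum.inl a := by
  rw [Tangle.follow, dif_neg fun ⟨p, hp⟩ => ha ⟨Sum.inl p, hp⟩,
    dif_neg fun ⟨o, ho⟩ => ha ⟨Sum.inr o, ho⟩]

theorem Tangle.endWeight_enter [Group H] (D : Tangle I O) (f h : X × X → H) (C : D.Arc → X)
    (p : D.Crossing × Strand) : D.endWeight f h C (D.enter p) = D.passageWeight f h C p := by
  have hp : ∃ q, D.enter q = D.enter p := ⟨p, rfl⟩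
  rw [Tangle.endWeight, dif_pos hp, D.enter_injective hp.choose_spec]

theorem Tangle.endWeight_eq_one [Group H] (D : Tangle I O) (f h : X × X → H) (C : D.Arc → X)
    {a : D.Arc} (ha : a ∉ Set.range D.enter) : D.endWeight f h C a = 1 :=
  dif_neg ha

theorem Tangle.endWeight_target [Group H] (D : Tangle I O) (f h : X × X → H) (C : D.Arc → X)
    (o : O) : D.endWeight f h C (D.target o) = 1 :=
  D.endWeight_eq_one f h C fun ⟨p, hp⟩ => D.enter_ne_target p o hp

/-- A semi-arc ends at a crossing, or ends at a boundary point, or is a circle. -/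
theorem Tangle.end_cases (D : Tangle I O) (a : D.Arc) :
    (∃ p, D.enter p = a) ∨ (∃ o, D.target o = a) ∨
      a ∉ Set.range (Sum.elim D.enter D.target) := by
  by_cases ha : a ∈ Set.range (Sum.elim D.enter D.target)
  · obtain ⟨p | o, h⟩ := ha
    exacts [Or.inl ⟨p, h⟩, Or.inr (Or.inl ⟨o, h⟩)]
  · exact Or.inr (Or.inr ha)

/-- A semi-arc starts at a crossing, or starts at a boundary point, or is a circle. -/
theorem Tangle.start_cases (D : Tangle I O) (a : D.Arc) :
    (∃ p, D.leave p = a) ∨ (∃ i, D.source i = a) ∨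
      a ∉ Set.range (Sum.elim D.enter D.target) := by
  rw [D.range_eq]
  by_cases ha : a ∈ Set.range (Sum.elim D.leave D.source)
  · obtain ⟨p | o, h⟩ := ha
    exacts [Or.inl ⟨p, h⟩, Or.inr (Or.inl ⟨o, h⟩)]
  · exact Or.inr (Or.inr ha)

theorem LinkDiagram.next_enter (D : LinkDiagram) (p : D.Crossing × Strand) :
    D.next (D.enter p) = D.leave p := by
  have hp : ∃ q, D.enter q = D.enter p := ⟨p, rfl⟩
  rw [LinkDiagram.next, dif_pos hp, D.enter_injective hp.choose_spec]

theorem LinkDiagram.next_circle (D : LinkDiagram) {a : D.Arc} (ha : a ∉ Set.range D.enter) :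
    D.next a = a :=
  dif_neg ha

theorem LinkDiagram.exists_enter_eq_leave (D : LinkDiagram) (p : D.Crossing × Strand) :
    ∃ q, D.enter q = D.leave p := by
  obtain ⟨q | q, hq⟩ : D.leave p ∈ Set.range (Sum.elim D.enter D.target) := by
    rw [D.range_eq]
    exact ⟨Sum.inl p, rfl⟩
  · exact ⟨q, hq⟩
  · exact q.elim

theorem LinkDiagram.next_injective (D : LinkDiagram) : Function.Injective D.next := by
  have := D.finite_arc
  refine Finite.injective_iff_surjective.2 fun a => ?_
  rcases D.start_cases a with ⟨p, rfl⟩ | ⟨i, -⟩ | ha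
  · exact ⟨D.enter p, D.next_enter p⟩
  · exact i.elim
  · exact ⟨a, D.next_circle fun ⟨p, hp⟩ => ha ⟨Sum.inl p, hp⟩⟩

/-- The product along a component does not depend on the base point up to conjugation. -/
theorem LinkDiagram.isConj_componentProduct [Group H] (D : LinkDiagram) (f h : X × X → H)
    (C : D.Arc → X) {a b : D.Arc} (hab : D.component a = D.component b) :
    IsConj (D.componentProduct f h C a) (D.componentProduct f h C b) := by
  have := D.finite_arc
  have key := Quot.eqvGen_exact hab
  clear hab
  induction key with
  | rel a b hab =>
    subst hab
    exact isConj_cycleProduct_apply D.next_injective (LinkDiagram.arcWeight D f h C) a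
  | refl a => exact IsConj.refl _
  | symm a b _ ih => exact ih.symm
  | trans a b c _ _ ih ih' => exact ih.trans ih'

end Follow

/-! ### Gluing two tangles -/

section Gluing

variable {X H : Type*} {m : ℕ} {W T : Tangle (Fin m) (Fin m)} {D : LinkDiagram}

/-- Travelling through the glued diagram, one piece of a semi-arc at a time: a step leads through a
crossing or across the boundary of the disc. -/
noncomputable def pieceStep (W T : Tangle (Fin m) (Fin m)) : W.Arc ⊕ T.Arc → W.Arc ⊕ T.Arc
  | Sum.inl w => Sum.elim Sum.inl (fun k => Sum.inr (T.source k)) (W.follow w)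
  | Sum.inr t => Sum.elim Sum.inr (fun k => Sum.inl (W.source k)) (T.follow t)

/-- The weight met at the end of a piece of a semi-arc. -/
noncomputable def pieceWeight [Group H] (f h : X × X → H) (Cw : W.Arc → X) (Ct : T.Arc → X) :
    W.Arc ⊕ T.Arc → H :=
  Sum.elim (W.endWeight f h Cw) (T.endWeight f h Ct)

theorem pieceStep_injective (W T : Tangle (Fin m) (Fin m)) :
    Function.Injective (pieceStep W T) := by
  have := W.finite_arc
  have := T.finite_arc
  refine Finite.injective_iff_surjective.2 ?_
  rintro (w | t)
  · rcases W.start_cases w with ⟨p, rfl⟩ | ⟨k, rfl⟩ | hw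
    · exact ⟨Sum.inl (W.enter p), by simp [pieceStep, Tangle.follow_enter]⟩
    · exact ⟨Sum.inr (T.target k), by simp [pieceStep, Tangle.follow_target]⟩
    · exact ⟨Sum.inl w, by simp [pieceStep, W.follow_circle hw]⟩
  · rcases T.start_cases t with ⟨p, rfl⟩ | ⟨k, rfl⟩ | ht
    · exact ⟨Sum.inr (T.enter p), by simp [pieceStep, Tangle.follow_enter]⟩
    · exact ⟨Sum.inl (W.target k), by simp [pieceStep, Tangle.follow_target]⟩
    · exact ⟨Sum.inr t, by simp [pieceStep, T.follow_circle ht]⟩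

theorem pieceStep_of_meets {q q' : W.Arc ⊕ T.Arc} (hq : Tangle.Meets W T q q') :
    pieceStep W T q = q' := by
  cases hq <;> simp [pieceStep, Tangle.follow_target]

/-- The product along a cycle of pieces is the same, up to conjugation, for all the pieces of a
semi-arc. -/
theorem isConj_cycleProduct_of_eqvGen [Group H] (w : W.Arc ⊕ T.Arc → H) {q q' : W.Arc ⊕ T.Arc}
    (hq : Relation.EqvGen (Tangle.Meets W T) q q') :
    IsConj (cycleProduct (pieceStep W T) w q) (cycleProduct (pieceStep W T) w q') := by
  have := W.finite_arc
  have := T.finite_arc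
  induction hq with
  | rel a b hab =>
    rw [← pieceStep_of_meets hab]
    exact isConj_cycleProduct_apply (pieceStep_injective W T) _ _
  | refl a => exact IsConj.refl _
  | symm a b _ ih => exact ih.symm
  | trans a b c _ _ ih ih' => exact ih.trans ih'

namespace Gluing

/-- The last piece of the semi-arc that enters a crossing. -/
def enterPiece (g : Gluing W T D) (p : D.Crossing × Strand) : W.Arc ⊕ T.Arc :=
  Sum.elim (fun c => Sum.inl (W.enter (c, p.2))) (fun c => Sum.inr (T.enter (c, p.2)))
    (g.crossing.symm p.1)

theorem crossing_cases (g : Gluing W T D) (p : D.Crossing × Strand) :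
    (∃ c s, p = (g.crossing (Sum.inl c), s)) ∨ ∃ c s, p = (g.crossing (Sum.inr c), s) := by
  obtain ⟨d, s⟩ := p
  obtain ⟨c | c, rfl⟩ := g.crossing.surjective d
  exacts [Or.inl ⟨c, s, rfl⟩, Or.inr ⟨c, s, rfl⟩]

theorem enterPiece_inl (g : Gluing W T D) (c : W.Crossing) (s : Strand) :
    g.enterPiece (g.crossing (Sum.inl c), s) = Sum.inl (W.enter (c, s)) := by
  simp [enterPiece]

theorem enterPiece_inr (g : Gluing W T D) (c : T.Crossing) (s : Strand) :
    g.enterPiece (g.crossing (Sum.inr c), s) = Sum.inr (T.enter (c, s)) := by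
  simp [enterPiece]

theorem arc_enterPiece (g : Gluing W T D) (p : D.Crossing × Strand) :
    g.arc (g.enterPiece p) = D.enter p := by
  rcases g.crossing_cases p with ⟨c, s, rfl⟩ | ⟨c, s, rfl⟩
  · rw [enterPiece_inl, g.enter_outside]
  · rw [enterPiece_inr, g.enter_inside]

theorem enterPiece_injective (g : Gluing W T D) : Function.Injective g.enterPiece :=
  fun p q h => D.enter_injective (by rw [← g.arc_enterPiece, ← g.arc_enterPiece, h])

theorem arc_pieceStep_enterPiece (g : Gluing W T D) (p : D.Crossing × Strand) :
    g.arc (pieceStep W T (g.enterPiece p)) = D.leave p := by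
  rcases g.crossing_cases p with ⟨c, s, rfl⟩ | ⟨c, s, rfl⟩
  · simp [enterPiece_inl, g.leave_outside, pieceStep, Tangle.follow_enter]
  · simp [enterPiece_inr, g.leave_inside, pieceStep, Tangle.follow_enter]

theorem arc_eq_of_meets (g : Gluing W T D) {q q' : W.Arc ⊕ T.Arc} (h : Tangle.Meets W T q q') :
    g.arc q = g.arc q' :=
  (g.arc_eq_iff _ _).2 (Relation.EqvGen.rel _ _ h)

theorem mem_range_enterPiece_inl (g : Gluing W T D) (p : W.Crossing × Strand) :
    Sum.inl (W.enter p) ∈ Set.range g.enterPiece :=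
  ⟨(g.crossing (Sum.inl p.1), p.2), g.enterPiece_inl _ _⟩

theorem mem_range_enterPiece_inr (g : Gluing W T D) (p : T.Crossing × Strand) :
    Sum.inr (T.enter p) ∈ Set.range g.enterPiece :=
  ⟨(g.crossing (Sum.inr p.1), p.2), g.enterPiece_inr _ _⟩

/-- A step that does not lead through a crossing stays on the same semi-arc. -/
theorem arc_pieceStep_of_notMem (g : Gluing W T D) {q : W.Arc ⊕ T.Arc}
    (hq : q ∉ Set.range g.enterPiece) : g.arc (pieceStep W T q) = g.arc q := by
  rcases q with w | t
  · rcases W.end_cases w with ⟨p, rfl⟩ | ⟨k, rfl⟩ | hw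
    · exact absurd (g.mem_range_enterPiece_inl p) hq
    · rw [pieceStep_of_meets (.into k), g.arc_eq_of_meets (.into k)]
    · simp [pieceStep, W.follow_circle hw]
  · rcases T.end_cases t with ⟨p, rfl⟩ | ⟨k, rfl⟩ | ht
    · exact absurd (g.mem_range_enterPiece_inr p) hq
    · rw [pieceStep_of_meets (.out k), g.arc_eq_of_meets (.out k)]
    · simp [pieceStep, T.follow_circle ht]

theorem component_arc_pieceStep (g : Gluing W T D) (q : W.Arc ⊕ T.Arc) :
    D.component (g.arc (pieceStep W T q)) = D.component (g.arc q) := by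
  by_cases hq : q ∈ Set.range g.enterPiece
  · obtain ⟨p, rfl⟩ := hq
    rw [g.arc_pieceStep_enterPiece, g.arc_enterPiece]
    exact (Quot.sound (r := fun a b => D.next a = b) (D.next_enter p)).symm
  · rw [g.arc_pieceStep_of_notMem hq]

section Weights

variable [Group H] (f h : X × X → H)

theorem coloredAt_inl_iff (g : Gluing W T D) (S τ : X × X → X × X) (C : D.Arc → X)
    (c : W.Crossing) : D.ColoredAt S τ C (g.crossing (Sum.inl c)) ↔
      W.ColoredAt S τ (fun w => C (g.arc (Sum.inl w))) c := by
  rw [Tangle.coloredAt_iff, Tangle.coloredAt_iff, g.kind_outside]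
  simp only [Tangle.colorsIn, Tangle.colorsOut, g.enter_outside, g.leave_outside]

theorem coloredAt_inr_iff (g : Gluing W T D) (S τ : X × X → X × X) (C : D.Arc → X)
    (c : T.Crossing) : D.ColoredAt S τ C (g.crossing (Sum.inr c)) ↔
      T.ColoredAt S τ (fun t => C (g.arc (Sum.inr t))) c := by
  rw [Tangle.coloredAt_iff, Tangle.coloredAt_iff, g.kind_inside]
  simp only [Tangle.colorsIn, Tangle.colorsOut, g.enter_inside, g.leave_inside]

theorem pieceWeight_enterPiece (g : Gluing W T D) (C : D.Arc → X) (p : D.Crossing × Strand) :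
    pieceWeight f h (fun w => C (g.arc (Sum.inl w))) (fun t => C (g.arc (Sum.inr t)))
      (g.enterPiece p) = D.passageWeight f h C p := by
  rcases g.crossing_cases p with ⟨c, s, rfl⟩ | ⟨c, s, rfl⟩
  · rw [enterPiece_inl, pieceWeight, Sum.elim_inl, Tangle.endWeight_enter,
      Tangle.passageWeight_eq_weight, Tangle.passageWeight_eq_weight, g.kind_outside]
    simp only [Tangle.colorsIn, Tangle.colorsOut, g.enter_outside, g.leave_outside]
  · rw [enterPiece_inr, pieceWeight, Sum.elim_inr, Tangle.endWeight_enter,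
      Tangle.passageWeight_eq_weight, Tangle.passageWeight_eq_weight, g.kind_inside]
    simp only [Tangle.colorsIn, Tangle.colorsOut, g.enter_inside, g.leave_inside]

theorem pieceWeight_of_notMem (g : Gluing W T D) (Cw : W.Arc → X) (Ct : T.Arc → X)
    {q : W.Arc ⊕ T.Arc} (hq : q ∉ Set.range g.enterPiece) : pieceWeight f h Cw Ct q = 1 := by
  rcases q with w | t
  · exact W.endWeight_eq_one f h _ fun ⟨p, hp⟩ => hq (hp ▸ g.mem_range_enterPiece_inl p)
  · exact T.endWeight_eq_one f h _ fun ⟨p, hp⟩ => hq (hp ▸ g.mem_range_enterPiece_inr p)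

/-- For a component with crossings, both the walk along the semi-arcs and the walk along their
pieces have as first return map the map from each passage to the next one. -/
theorem componentProduct_enter (g : Gluing W T D) (C : D.Arc → X) (p : D.Crossing × Strand) :
    D.componentProduct f h C (D.enter p) = cycleProduct (pieceStep W T)
      (pieceWeight f h (fun w => C (g.arc (Sum.inl w))) (fun t => C (g.arc (Sum.inr t))))
      (g.enterPiece p) := by
  have := D.finite_arc
  have := W.finite_arc
  have := T.finite_arc
  -- `nP` sends a passage to the next one on its component
  choose nP hnP using D.exists_enter_eq_leave
  trans cycleProduct nP (D.passageWeight f h C) p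
  · refine (cycleProduct_firstReturn D.next_injective (LinkDiagram.arcWeight D f h C)
      D.enter_injective (fun p => ⟨1, Nat.one_pos, ?_, ?_, ?_⟩) p).symm
    · rw [Function.iterate_one, D.next_enter, hnP]
    · intro i h0 h1
      omega
    · exact List.prod_singleton.trans (D.endWeight_enter f h C p)
  · refine cycleProduct_firstReturn (pieceStep_injective W T) _ g.enterPiece_injective
      (fun p => ?_) p
    have hex : ∃ r, 0 < r ∧ (pieceStep W T)^[r] (g.enterPiece p) ∈ Set.range g.enterPiece := by
      have hper := (pieceStep_injective W T).mem_periodicPts (g.enterPiece p)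
      exact ⟨_, Function.minimalPeriod_pos_of_mem_periodicPts hper, p,
        Function.iterate_minimalPeriod.symm⟩
    classical
    have hmin : ∀ i, 0 < i → i < Nat.find hex →
        (pieceStep W T)^[i] (g.enterPiece p) ∉ Set.range g.enterPiece :=
      fun i h0 hi hmem => Nat.find_min hex hi ⟨h0, hmem⟩
    -- between two passages one stays on the semi-arc that leaves the first one
    have harc : ∀ i, i < Nat.find hex →
        g.arc ((pieceStep W T)^[i + 1] (g.enterPiece p)) = D.leave p := by
      intro i
      induction i with
      | zero => exact fun _ => g.arc_pieceStep_enterPiece p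
      | succ i ih =>
        intro hi
        rw [Function.iterate_succ_apply', g.arc_pieceStep_of_notMem (hmin _ (Nat.succ_pos i) hi),
          ih (Nat.lt_of_succ_lt hi)]
    obtain ⟨hpos, p', hp'⟩ := Nat.find_spec hex
    obtain ⟨r, hr⟩ := Nat.exists_eq_succ_of_ne_zero hpos.ne'
    refine ⟨_, hpos, ?_, hmin, ?_⟩
    · have := harc r (by omega)
      rw [← Nat.succ_eq_add_one, ← hr, ← hp', g.arc_enterPiece, ← hnP] at this
      rw [← hp', D.enter_injective this]
    · rw [hr, List.prod_range_succ']
      rw [List.prod_eq_one, mul_one]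
      · exact g.pieceWeight_enterPiece f h C p
      · intro x hx
        obtain ⟨i, hi, rfl⟩ := List.mem_map.1 hx
        refine g.pieceWeight_of_notMem f h _ _ (hmin _ (Nat.succ_pos i) ?_)
        rw [hr]
        exact Nat.succ_lt_succ (List.mem_range.1 hi)

theorem isConj_cycleProduct_pieceStep (g : Gluing W T D) (C : D.Arc → X) (q : W.Arc ⊕ T.Arc) :
    IsConj (D.componentProduct f h C (g.arc q)) (cycleProduct (pieceStep W T)
      (pieceWeight f h (fun w => C (g.arc (Sum.inl w))) (fun t => C (g.arc (Sum.inr t)))) q) := by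
  by_cases hq : g.arc q ∈ Set.range D.enter
  · obtain ⟨p, hp⟩ := hq
    rw [← hp, g.componentProduct_enter]
    have := (g.arc_eq_iff (g.enterPiece p) q).1 (by rw [g.arc_enterPiece, hp])
    exact isConj_cycleProduct_of_eqvGen _ this
  · -- a circle without crossings
    have hnot : ∀ q', g.arc q' = g.arc q → q' ∉ Set.range g.enterPiece := by
      rintro _ hq' ⟨p, rfl⟩
      exact hq ⟨p, by rw [← hq', g.arc_enterPiece]⟩
    have harc : ∀ i, g.arc ((pieceStep W T)^[i] q) = g.arc q := by
      intro i
      induction i with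
      | zero => rfl
      | succ i ih => rw [Function.iterate_succ_apply', g.arc_pieceStep_of_notMem (hnot _ ih), ih]
    rw [cycleProduct_eq_one fun i => g.pieceWeight_of_notMem f h _ _ (hnot _ (harc i))]
    have : D.componentProduct f h C (g.arc q) = 1 := by
      refine cycleProduct_eq_one fun i => ?_
      rw [Function.iterate_fixed (D.next_circle hq)]
      exact D.endWeight_eq_one f h C hq
    rw [this]

end Weights

end Gluing

end Gluing

/-! ### Tangles made of strands inside of the disc -/

section Outside

variable {X H : Type*} {m n : ℕ} {K : Type} [Finite K]

theorem strandTangle_follow (kind : K → CrossingKind) {pass : K × Strand → Fin m × Fin n}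
    (hpass : Function.Bijective pass) (k : Fin m) (j : Fin n) :
    (strandTangle kind pass hpass).follow (k, j.castSucc) = Sum.inl (k, j.succ) := by
  obtain ⟨p, hp⟩ := hpass.2 (k, j)
  have := (strandTangle kind pass hpass).follow_enter p
  simp only [strandTangle] at this
  rw [hp] at this
  exact this

theorem strandTangle_endWeight [Group H] (kind : K → CrossingKind)
    {pass : K × Strand → Fin m × Fin n} (hpass : Function.Bijective pass) (f h : X × X → H)
    (C : Fin m × Fin (n + 1) → X) (k : Fin m) (j : Fin n) :
    (strandTangle kind pass hpass).endWeight f h C (k, j.castSucc) =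
      strandWeight kind pass f h C ((Equiv.ofBijective pass hpass).symm (k, j)) := by
  obtain ⟨p, hp⟩ := hpass.2 (k, j)
  have e : (Equiv.ofBijective pass hpass).symm (k, j) = p := (Equiv.symm_apply_eq _).2 hp.symm
  have hp' : (strandTangle kind pass hpass).enter p = (k, j.castSucc) := by
    simp [strandTangle, hp]
  rw [e, ← hp']
  exact ((strandTangle kind pass hpass).endWeight_enter f h C p).trans
    (Tangle.passageWeight_eq_weight (strandTangle kind pass hpass) f h C p)

/-- Travelling along the outer pieces of semi-arcs only, where the disc is traversed in one step. -/
noncomputable def outsideStep (W : Tangle (Fin m) (Fin m)) (w : W.Arc) : W.Arc :=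
  Sum.elim id W.source (W.follow w)

/-- The weight met in one step along the outer pieces of semi-arcs, when the strands in the disc
contribute the products `s`. -/
noncomputable def outsideWeight [Group H] (W : Tangle (Fin m) (Fin m)) (f h : X × X → H)
    (C : W.Arc → X) (s : Fin m → H) (w : W.Arc) : H :=
  Sum.elim (fun _ => W.endWeight f h C w) s (W.follow w)

variable {W : Tangle (Fin m) (Fin m)} {kind : K → CrossingKind}
  {pass : K × Strand → Fin m × Fin n} {hpass : Function.Bijective pass} {D : LinkDiagram}

theorem pieceStep_iterate_strand (k : Fin m) (j : ℕ) (hj : j < n + 1) :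
    (pieceStep W (strandTangle kind pass hpass))^[j + 1] (Sum.inl (W.target k)) =
      Sum.inr (k, ⟨j, hj⟩) := by
  induction j with
  | zero => exact pieceStep_of_meets (.into k)
  | succ j ih =>
    rw [Function.iterate_succ_apply', ih (by omega)]
    exact congrArg (Sum.elim Sum.inr fun k => Sum.inl (W.source k))
      (strandTangle_follow kind hpass k ⟨j, by omega⟩)

/-- The walk along the outer pieces is the first return map of the walk along all the pieces. -/
theorem cycleProduct_outsideStep [Group H] (f h : X × X → H) (Cw : W.Arc → X)
    (Ct : (strandTangle kind pass hpass).Arc → X) (w : W.Arc) :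
    cycleProduct (outsideStep W) (outsideWeight W f h Cw (strandProduct kind pass hpass f h Ct)) w =
      cycleProduct (pieceStep W (strandTangle kind pass hpass))
        (pieceWeight f h Cw Ct) (Sum.inl w) := by
  have := W.finite_arc
  have := (strandTangle kind pass hpass).finite_arc
  refine cycleProduct_firstReturn (pieceStep_injective W _) _ Sum.inl_injective (fun w => ?_) w
  rcases W.end_cases w with ⟨p, rfl⟩ | ⟨k, rfl⟩ | hw
  · refine ⟨1, Nat.one_pos, ?_, fun i h0 h1 => by omega, ?_⟩
    · simp [outsideStep, pieceStep, Tangle.follow_enter]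
    · simp [outsideWeight, pieceWeight, Tangle.follow_enter]
  · -- one step into the disc, `n` passages along the strand, and one step out of the disc
    refine ⟨n + 2, by omega, ?_, ?_, ?_⟩
    · rw [Function.iterate_succ_apply', pieceStep_iterate_strand k n (Nat.lt_succ_self n)]
      simp only [outsideStep, Tangle.follow_target, Sum.elim_inr]
      exact pieceStep_of_meets (T := strandTangle kind pass hpass) (.out k)
    · rintro (_ | i) h0 hi ⟨w', hw'⟩
      · omega
      · rw [pieceStep_iterate_strand k i (by omega)] at hw'
        exact Sum.inl_ne_inr hw'
    · have hlast : pieceWeight f h Cw Ct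
          ((pieceStep W (strandTangle kind pass hpass))^[n + 1] (Sum.inl (W.target k))) = 1 := by
        rw [pieceStep_iterate_strand k n (Nat.lt_succ_self n)]
        exact (strandTangle kind pass hpass).endWeight_target f h Ct k
      have hfirst : pieceWeight f h Cw Ct (Sum.inl (W.target k)) = 1 := W.endWeight_target f h Cw k
      rw [List.prod_range_succ', List.prod_range_succ, hlast, mul_one, Function.iterate_zero,
        id, hfirst, one_mul, outsideWeight, Tangle.follow_target, Sum.elim_inr]
      change _ = (List.ofFn fun j =>
        strandWeight kind pass f h Ct ((Equiv.ofBijective pass hpass).symm (k, j))).prod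
      congr 1
      refine List.ext_getElem (by simp) fun i h1 h2 => ?_
      have hi : i < n := by simpa using h1
      rw [List.getElem_map, List.getElem_range, List.getElem_ofFn,
        pieceStep_iterate_strand k i (by omega)]
      exact strandTangle_endWeight kind hpass f h Ct k ⟨i, hi⟩
  · refine ⟨1, Nat.one_pos, ?_, fun i h0 h1 => by omega, ?_⟩
    · simp [outsideStep, pieceStep, W.follow_circle hw]
    · simp [outsideWeight, pieceWeight, W.follow_circle hw]

namespace Gluing

/-- The cycle of the walk along the outer pieces that contains a piece, where the pieces of a strand
inside of the disc are assigned to the outer piece at the end of the strand. -/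
def outsideCycle (W : Tangle (Fin m) (Fin m)) (kind : K → CrossingKind)
    (pass : K × Strand → Fin m × Fin n) (hpass : Function.Bijective pass) :
    W.Arc ⊕ (strandTangle kind pass hpass).Arc → Quot fun v w : W.Arc => outsideStep W v = w
  | Sum.inl w => Quot.mk _ w
  | Sum.inr a => Quot.mk _ (W.source a.1)

theorem outsideCycle_pieceStep (q : W.Arc ⊕ (strandTangle kind pass hpass).Arc) :
    outsideCycle W kind pass hpass (pieceStep W (strandTangle kind pass hpass) q) =
      outsideCycle W kind pass hpass q := by
  rcases q with w | t
  · rcases W.end_cases w with ⟨p, rfl⟩ | ⟨k, rfl⟩ | hw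
    · simp only [pieceStep, Tangle.follow_enter, Sum.elim_inl, outsideCycle]
      exact (Quot.sound (by simp [outsideStep, Tangle.follow_enter])).symm
    · simp only [pieceStep, Tangle.follow_target, Sum.elim_inr, outsideCycle]
      exact (Quot.sound (by simp [outsideStep, Tangle.follow_target, strandTangle])).symm
    · simp [pieceStep, W.follow_circle hw]
  · obtain ⟨k, j⟩ := t
    induction j using Fin.lastCases with
    | last =>
      have e : pieceStep W (strandTangle kind pass hpass)
          (Sum.inr ((strandTangle kind pass hpass).target k)) = Sum.inl (W.source k) :=
        pieceStep_of_meets (.out k)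
      have e' := congrArg (outsideCycle W kind pass hpass) e
      exact e'
    | cast j =>
      exact congrArg (fun x => outsideCycle W kind pass hpass
          (Sum.elim Sum.inr (fun k => Sum.inl (W.source k)) x))
        (strandTangle_follow kind hpass k j)

theorem outsideCycle_eq_of_arc_eq (g : Gluing W (strandTangle kind pass hpass) D)
    {q q' : W.Arc ⊕ (strandTangle kind pass hpass).Arc} (hq : g.arc q = g.arc q') :
    outsideCycle W kind pass hpass q = outsideCycle W kind pass hpass q' := by
  have key := (g.arc_eq_iff q q').1 hq
  clear hq
  induction key with
  | rel a b hab => rw [← pieceStep_of_meets hab, outsideCycle_pieceStep]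
  | refl a => rfl
  | symm a b _ ih => exact ih.symm
  | trans a b c _ _ ih ih' => exact ih.trans ih'

theorem component_arc_iterate (g : Gluing W (strandTangle kind pass hpass) D)
    (q : W.Arc ⊕ (strandTangle kind pass hpass).Arc) (i : ℕ) :
    D.component (g.arc ((pieceStep W (strandTangle kind pass hpass))^[i] q)) =
      D.component (g.arc q) := by
  induction i with
  | zero => rfl
  | succ i ih => rw [Function.iterate_succ_apply', g.component_arc_pieceStep, ih]

theorem component_arc_source (g : Gluing W (strandTangle kind pass hpass) D) (k : Fin m)
    (j : Fin (n + 1)) :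
    D.component (g.arc (Sum.inr (k, j))) = D.component (g.arc (Sum.inl (W.source k))) := by
  rw [← g.arc_eq_of_meets (.out k)]
  have h1 := g.component_arc_iterate (Sum.inl (W.target k)) (j + 1)
  have h2 := g.component_arc_iterate (Sum.inl (W.target k)) (n + 1)
  rw [pieceStep_iterate_strand k j j.2] at h1
  rw [pieceStep_iterate_strand k n (Nat.lt_succ_self n)] at h2
  exact h1.trans h2.symm

theorem component_arc_outsideStep (g : Gluing W (strandTangle kind pass hpass) D) (w : W.Arc) :
    D.component (g.arc (Sum.inl (outsideStep W w))) = D.component (g.arc (Sum.inl w)) := by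
  rw [← g.component_arc_pieceStep (Sum.inl w), outsideStep, pieceStep]
  obtain w' | k := W.follow w
  · rfl
  · exact (g.component_arc_source k 0).symm

theorem exists_component_eq (g : Gluing W (strandTangle kind pass hpass) D) (a : D.Arc) :
    ∃ w, D.component a = D.component (g.arc (Sum.inl w)) := by
  obtain ⟨w | ⟨k, j⟩, rfl⟩ := g.arc_surjective a
  exacts [⟨w, rfl⟩, ⟨_, g.component_arc_source k j⟩]

/-- The components of a glued diagram are the cycles of the walk along the outer pieces. They do not
depend on the tangle inside of the disc, as long as its `k`-th strand joins the `k`-th incoming to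
the `k`-th outgoing boundary point. -/
theorem exists_component_equiv (g : Gluing W (strandTangle kind pass hpass) D) :
    ∃ e : (Quot fun v w : W.Arc => outsideStep W v = w) ≃ LinkDiagram.Component D,
      ∀ w, e (Quot.mk _ w) = D.component (g.arc (Sum.inl w)) := by
  -- the cycle of the outer walk met by a semi-arc of `D` is constant along the components
  have invariant : ∀ a b : D.Arc, D.next a = b →
      outsideCycle W kind pass hpass (Function.surjInv g.arc_surjective a) =
        outsideCycle W kind pass hpass (Function.surjInv g.arc_surjective b) := by
    rintro a _ rfl
    by_cases ha : a ∈ Set.range D.enter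
    · obtain ⟨p, rfl⟩ := ha
      rw [g.outsideCycle_eq_of_arc_eq (q' := g.enterPiece p)
        (by rw [Function.surjInv_eq g.arc_surjective, g.arc_enterPiece]), ← outsideCycle_pieceStep]
      refine g.outsideCycle_eq_of_arc_eq ?_
      rw [Function.surjInv_eq g.arc_surjective, g.arc_pieceStep_enterPiece, D.next_enter]
    · rw [D.next_circle ha]
  let F : (Quot fun v w : W.Arc => outsideStep W v = w) → LinkDiagram.Component D :=
    Quot.lift (fun w => D.component (g.arc (Sum.inl w))) fun v w hvw => by
      rw [← hvw, g.component_arc_outsideStep]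
  let G : LinkDiagram.Component D → Quot fun v w : W.Arc => outsideStep W v = w :=
    Quot.lift (fun a => outsideCycle W kind pass hpass (Function.surjInv g.arc_surjective a))
      invariant
  have hGF : ∀ w, G (D.component (g.arc (Sum.inl w))) = Quot.mk _ w := fun w =>
    g.outsideCycle_eq_of_arc_eq (q' := Sum.inl w) (Function.surjInv_eq _ _)
  refine ⟨⟨F, G, fun x => ?_, fun x => ?_⟩, fun w => rfl⟩
  · obtain ⟨w, rfl⟩ := Quot.exists_rep x
    exact hGF w
  · obtain ⟨a, rfl⟩ := Quot.exists_rep x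
    obtain ⟨w, hw⟩ := g.exists_component_eq a
    change F (G (D.component a)) = D.component a
    rw [hw, hGF]

/-- The product along a component of a glued diagram, computed along the outer pieces. -/
theorem isConj_cycleProduct_outsideStep [Group H] (g : Gluing W (strandTangle kind pass hpass) D)
    (f h : X × X → H) (C : D.Arc → X) (w : W.Arc) :
    IsConj (D.componentProduct f h C (g.arc (Sum.inl w)))
      (cycleProduct (outsideStep W) (outsideWeight W f h (fun w => C (g.arc (Sum.inl w)))
        (strandProduct kind pass hpass f h fun t => C (g.arc (Sum.inr t)))) w) := by
  have e := cycleProduct_outsideStep (hpass := hpass) f h (fun w => C (g.arc (Sum.inl w)))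
    (fun t => C (g.arc (Sum.inr t))) w
  exact (congrArg (IsConj (D.componentProduct f h C (g.arc (Sum.inl w)))) e).mpr
    (g.isConj_cycleProduct_pieceStep f h C (Sum.inl w))

section Colorings

variable {S τ : X × X → X × X}

theorem isStrandColoring (g : Gluing W (strandTangle kind pass hpass) D) (C : D.Coloring S τ) :
    IsStrandColoring S τ kind pass fun t => C.1 (g.arc (Sum.inr t)) := fun c =>
  (Tangle.coloredAt_iff _ _ _ _ _).1 ((g.coloredAt_inr_iff S τ C.1 c).1 (C.2 _))

theorem apply_target (g : Gluing W (strandTangle kind pass hpass) D) (C : D.Arc → X) (k : Fin m) :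
    C (g.arc (Sum.inr (k, 0))) = C (g.arc (Sum.inl (W.target k))) := by
  rw [g.arc_eq_of_meets (.into k)]
  rfl

theorem apply_source (g : Gluing W (strandTangle kind pass hpass) D) (C : D.Arc → X) (k : Fin m) :
    C (g.arc (Sum.inr (k, Fin.last n))) = C (g.arc (Sum.inl (W.source k))) := by
  rw [← g.arc_eq_of_meets (.out k)]
  rfl

theorem coloring_ext (g : Gluing W (strandTangle kind pass hpass) D)
    (hu : DeterminedByBoundary S τ kind pass) {C C' : D.Coloring S τ}
    (hC : ∀ w, C.1 (g.arc (Sum.inl w)) = C'.1 (g.arc (Sum.inl w))) : C = C' := by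
  have hT := hu _ _ (g.isStrandColoring C) (g.isStrandColoring C')
    (fun k => ((g.apply_target C.1 k).trans (hC _)).trans (g.apply_target C'.1 k).symm)
    (fun k => ((g.apply_source C.1 k).trans (hC _)).trans (g.apply_source C'.1 k).symm)
  refine Subtype.ext (funext fun a => ?_)
  obtain ⟨w | t, rfl⟩ := g.arc_surjective a
  exacts [hC w, congrFun hT t]

/-- Colorings of the two parts that agree on the boundary of the disc are glued. -/
theorem exists_coloring (g : Gluing W (strandTangle kind pass hpass) D) {Cw : W.Arc → X}
    {Ct : Fin m × Fin (n + 1) → X} (hw : ∀ c, W.ColoredAt S τ Cw c)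
    (ht : IsStrandColoring S τ kind pass Ct) (h0 : ∀ k, Ct (k, 0) = Cw (W.target k))
    (h1 : ∀ k, Ct (k, Fin.last n) = Cw (W.source k)) :
    ∃ C : D.Coloring S τ, (∀ w, C.1 (g.arc (Sum.inl w)) = Cw w) ∧
      ∀ t, C.1 (g.arc (Sum.inr t)) = Ct t := by
  let Q : W.Arc ⊕ (strandTangle kind pass hpass).Arc → X := Sum.elim Cw Ct
  have hQ : ∀ q q', Relation.EqvGen (Tangle.Meets W (strandTangle kind pass hpass)) q q' →
      Q q = Q q' := by
    intro q q' hq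
    induction hq with
    | rel a b hab =>
      cases hab with
      | out k => exact h1 k
      | into k => exact (h0 k).symm
    | refl a => rfl
    | symm a b _ ih => exact ih.symm
    | trans a b c _ _ ih ih' => exact ih.trans ih'
  have hC : ∀ q, Q (Function.surjInv g.arc_surjective (g.arc q)) = Q q := fun q =>
    hQ _ _ ((g.arc_eq_iff _ _).1 (Function.surjInv_eq _ _))
  refine ⟨⟨fun a => Q (Function.surjInv g.arc_surjective a), fun d => ?_⟩,
    fun w => hC (Sum.inl w), fun t => hC (Sum.inr t)⟩
  obtain ⟨c | c, rfl⟩ := g.crossing.surjective d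
  · rw [g.coloredAt_inl_iff]
    simp only [hC]
    exact hw c
  · rw [g.coloredAt_inr_iff]
    simp only [hC]
    exact (Tangle.coloredAt_iff _ _ _ _ _).2 (ht c)

variable [Group H] {f h : X × X → H} {n' : ℕ} {K' : Type} [Finite K'] {kind' : K' → CrossingKind}
  {pass' : K' × Strand → Fin m × Fin n'} {hpass' : Function.Bijective pass'} {D' : LinkDiagram}

theorem exists_matching_coloring (g : Gluing W (strandTangle kind pass hpass) D)
    (g' : Gluing W (strandTangle kind' pass' hpass') D')
    (hm : ColoringsMatch S τ f h kind pass hpass kind' pass' hpass') (C : D.Coloring S τ) :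
    ∃ C' : D'.Coloring S τ, (∀ w, C'.1 (g'.arc (Sum.inl w)) = C.1 (g.arc (Sum.inl w))) ∧
      ∀ k, strandProduct kind' pass' hpass' f h (fun t => C'.1 (g'.arc (Sum.inr t))) k =
        strandProduct kind pass hpass f h (fun t => C.1 (g.arc (Sum.inr t))) k := by
  obtain ⟨Ct, ht, h0, h1, hp⟩ := hm _ (g.isStrandColoring C)
  obtain ⟨C', hw', ht'⟩ := g'.exists_coloring
    (fun c => (g.coloredAt_inl_iff S τ C.1 c).1 (C.2 _)) ht
    (fun k => (h0 k).trans (g.apply_target C.1 k)) (fun k => (h1 k).trans (g.apply_source C.1 k))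
  refine ⟨C', hw', fun k => ?_⟩
  rw [← hp k]
  exact congrArg (fun c => strandProduct kind' pass' hpass' f h c k) (funext ht')

end Colorings

end Gluing

end Outside

/-! ### Invariance under the moves -/

section Invariance

variable {X H : Type*} [Group H]

/-- Replacing the tangle `T` by `T'` inside of a disc changes neither the colorings nor, up to
conjugation, their products along the components. -/
def InvariantUnder (S τ : X × X → X × X) (f h : X × X → H) {m : ℕ}
    (T T' : Tangle (Fin m) (Fin m)) : Prop :=
  ∀ (W : Tangle (Fin m) (Fin m)) (D D' : LinkDiagram) (g : Gluing W T D) (g' : Gluing W T' D'),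
    ∃ Φ : D.Coloring S τ ≃ D'.Coloring S τ,
      (∀ C C', Φ C = C' ↔
        ∀ w : W.Arc, C'.1 (g'.arc (Sum.inl w)) = C.1 (g.arc (Sum.inl w))) ∧
      ∃ κ : LinkDiagram.Component D ≃ LinkDiagram.Component D',
        (∀ w : W.Arc, κ (LinkDiagram.component D (g.arc (Sum.inl w))) =
          LinkDiagram.component D' (g'.arc (Sum.inl w))) ∧
        ∀ (C : D.Coloring S τ) (a : D.Arc) (a' : D'.Arc),
          κ (LinkDiagram.component D a) = LinkDiagram.component D' a' →
          IsConj (LinkDiagram.componentProduct D f h C.1 a)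
            (LinkDiagram.componentProduct D' f h (Φ C).1 a')

variable {S τ : X × X → X × X} {f h : X × X → H} {m : ℕ}

theorem InvariantUnder.symm {T T' : Tangle (Fin m) (Fin m)} (hT : InvariantUnder S τ f h T T') :
    InvariantUnder S τ f h T' T := by
  intro W D D' g g'
  obtain ⟨Φ, hΦ, κ, hκ, hp⟩ := hT W D' D g' g
  refine ⟨Φ.symm, fun C C' => ?_, κ.symm, fun w => ?_, fun C a a' ha => ?_⟩
  · rw [Equiv.symm_apply_eq, eq_comm, hΦ]
    exact forall_congr' fun w => eq_comm
  · rw [Equiv.symm_apply_eq, hκ]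
  · have := hp (Φ.symm C) a' a (by rw [← ha, Equiv.apply_symm_apply])
    rw [Equiv.apply_symm_apply] at this
    exact this.symm

/-- It suffices that the colorings inside of the disc with given boundary colors are unique, and
correspond to each other with the same product along each strand. -/
theorem invariantUnder_of_coloringsMatch {n n' : ℕ} {K K' : Type} [Finite K] [Finite K']
    {kind : K → CrossingKind} {pass : K × Strand → Fin m × Fin n} {hpass : Function.Bijective pass}
    {kind' : K' → CrossingKind} {pass' : K' × Strand → Fin m × Fin n'}
    {hpass' : Function.Bijective pass'}
    (hm : ColoringsMatch S τ f h kind pass hpass kind' pass' hpass')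
    (hm' : ColoringsMatch S τ f h kind' pass' hpass' kind pass hpass)
    (hu : DeterminedByBoundary S τ kind pass) (hu' : DeterminedByBoundary S τ kind' pass') :
    InvariantUnder S τ f h (strandTangle kind pass hpass) (strandTangle kind' pass' hpass') := by
  intro W D D' g g'
  choose Φ hΦ hp using g.exists_matching_coloring g' hm
  choose Ψ hΨ _ using g'.exists_matching_coloring g hm'
  obtain ⟨e, he⟩ := g.exists_component_equiv
  obtain ⟨e', he'⟩ := g'.exists_component_equiv
  refine ⟨⟨Φ, Ψ, fun C => g.coloring_ext hu fun w => ?_, fun C => g'.coloring_ext hu' fun w => ?_⟩,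
    fun C C' => ⟨?_, fun hC => g'.coloring_ext hu' fun w => ?_⟩, e.symm.trans e', fun w => ?_,
    fun C a a' ha => ?_⟩
  · rw [hΨ, hΦ]
  · rw [hΦ, hΨ]
  · rintro rfl
    exact hΦ C
  · rw [hC]
    exact hΦ C w
  · rw [← he, Equiv.trans_apply, Equiv.symm_apply_apply, he']
  · obtain ⟨w, hw⟩ := g.exists_component_eq a
    rw [hw, ← he, Equiv.trans_apply, Equiv.symm_apply_apply, he'] at ha
    have h1 := g.isConj_cycleProduct_outsideStep f h C.1 w
    have h2 := g'.isConj_cycleProduct_outsideStep f h (Φ C).1 w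
    rw [funext (hΦ C), funext (hp C)] at h2
    exact ((D.isConj_componentProduct f h C.1 hw).trans h1).trans
      (h2.symm.trans (D'.isConj_componentProduct f h (Φ C).1 ha))

theorem invariantUnder_triangle_over (hS : IsSingularPair S τ)
    (hfh : IsNonCommCocyclePair S τ f h) (b01 b02 b12 d : Bool) (κ : CrossingKind) :
    InvariantUnder S τ f h
      (triangleTangle b01 b02 b12 d (CrossingKind.ofSign b01) (CrossingKind.ofSign b02) κ)
      (triangleTangle b01 b02 b12 (!d) (CrossingKind.ofSign b01) (CrossingKind.ofSign b02) κ) := by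
  have hp : ∀ d, Function.Bijective (trianglePass b01 b02 b12 d) := by
    cases b01 <;> cases b02 <;> cases b12 <;> decide
  refine invariantUnder_of_coloringsMatch (hpass := hp d) (hpass' := hp !d)
    (coloringsMatch_triangle_over hS hfh b01 b02 b12 d κ _ _) ?_
    (determinedByBoundary_two hS _ _ (hp _).2) (determinedByBoundary_two hS _ _ (hp _).2)
  have := coloringsMatch_triangle_over hS hfh b01 b02 b12 (!d) κ (hp _) (hp _)
  simpa only [Bool.not_not] using this

theorem invariantUnder_triangle_under (hS : IsSingularPair S τ)
    (hfh : IsNonCommCocyclePair S τ f h) (b01 b02 b12 d : Bool) (κ : CrossingKind) :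
    InvariantUnder S τ f h
      (triangleTangle b01 b02 b12 d (CrossingKind.ofSign !b01) (CrossingKind.ofSign !b02) κ)
      (triangleTangle b01 b02 b12 (!d) (CrossingKind.ofSign !b01) (CrossingKind.ofSign !b02)
        κ) := by
  have hp : ∀ d, Function.Bijective (trianglePass b01 b02 b12 d) := by
    cases b01 <;> cases b02 <;> cases b12 <;> decide
  refine invariantUnder_of_coloringsMatch (hpass := hp d) (hpass' := hp !d)
    (coloringsMatch_triangle_under hS hfh b01 b02 b12 d κ _ _) ?_
    (determinedByBoundary_two hS _ _ (hp _).2) (determinedByBoundary_two hS _ _ (hp _).2)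
  have := coloringsMatch_triangle_under hS hfh b01 b02 b12 (!d) κ (hp _) (hp _)
  simpa only [Bool.not_not] using this

theorem invariantUnder_twist (hS : IsSingularPair S τ) (hfh : IsNonCommCocyclePair S τ f h)
    (positive ltr0 first0 first1 : Bool) :
    InvariantUnder S τ f h (twistTangle positive ltr0 first0 first1)
      (twistTangle positive (!ltr0) (!first0) (!first1)) := by
  have hp : ∀ l a b, Function.Bijective (twistPass l a b) := by decide
  refine invariantUnder_of_coloringsMatch (hpass := hp ltr0 first0 first1) (hpass' := hp _ _ _)
    (coloringsMatch_twist hS hfh positive ltr0 first0 first1 _ _) ?_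
    (determinedByBoundary_two hS _ _ (hp _ _ _).2) (determinedByBoundary_two hS _ _ (hp _ _ _).2)
  have := coloringsMatch_twist hS hfh positive (!ltr0) (!first0) (!first1) (hp _ _ _) (hp _ _ _)
  simpa only [Bool.not_not] using this

theorem invariantUnder_of_reidemeisterMove (hS : IsSingularPair S τ)
    (hfh : IsNonCommCocyclePair S τ f h) {T T' : Tangle (Fin m) (Fin m)}
    (hT : ReidemeisterMove T T') : InvariantUnder S τ f h T T' := by
  induction hT with
  | RI positive left =>
    have hp : Function.Bijective (curlPass left) := by cases left <;> decide
    exact invariantUnder_of_coloringsMatch (hpass' := hp)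
      (coloringsMatch_plain_curl hS hfh _ _ _ positive left hp)
      (coloringsMatch_curl_plain hS hfh _ _ _ positive left hp)
      (determinedByBoundary_zero S τ _ _) (determinedByBoundary_two hS _ _ hp.2)
  | RII positive parallel =>
    have hp : Function.Bijective (bigonPass positive parallel) := by
      cases positive <;> cases parallel <;> decide
    exact invariantUnder_of_coloringsMatch (hpass' := hp)
      (coloringsMatch_plain_bigon hS _ _ _ positive parallel hp)
      (coloringsMatch_bigon_plain hS _ _ _ positive parallel hp)
      (determinedByBoundary_zero S τ _ _) (determinedByBoundary_two hS _ _ hp.2)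
  | RIII b01 b02 b12 d => exact invariantUnder_triangle_over hS hfh b01 b02 b12 d _
  | RIV under b01 b02 b12 d =>
    cases under
    · simpa only [Bool.xor_false] using invariantUnder_triangle_over hS hfh b01 b02 b12 d _
    · simpa only [Bool.xor_true] using invariantUnder_triangle_under hS hfh b01 b02 b12 d _
  | RV positive ltr0 first0 first1 => exact invariantUnder_twist hS hfh positive ltr0 first0 first1
  | symm _ ih => exact ih.symm

end Invariance

theorem mainTheorem3 {X H : Type*} [Group H] (S τ : X × X → X × X) (hS : IsSingularPair S τ)
    (f h : X × X → H) (hfh : IsNonCommCocyclePair S τ f h)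
    {m : ℕ} (W T T' : Tangle (Fin m) (Fin m)) (hT : ReidemeisterMove T T')
    (D D' : LinkDiagram) (g : Gluing W T D) (g' : Gluing W T' D') :
    ∃ Φ : D.Coloring S τ ≃ D'.Coloring S τ,
      -- `Φ C` is the one coloring that agrees with `C` outside of the disc of the move
      (∀ C C', Φ C = C' ↔
        ∀ w : W.Arc, C'.1 (g'.arc (Sum.inl w)) = C.1 (g.arc (Sum.inl w))) ∧
      -- the components of both diagrams correspond to each other outside of the disc, and
      -- for corresponding components, with any base points, the products are conjugate
      ∃ κ : LinkDiagram.Component D ≃ LinkDiagram.Component D',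
        (∀ w : W.Arc, κ (LinkDiagram.component D (g.arc (Sum.inl w))) =
          LinkDiagram.component D' (g'.arc (Sum.inl w))) ∧
        ∀ (C : D.Coloring S τ) (a : D.Arc) (a' : D'.Arc),
          κ (LinkDiagram.component D a) = LinkDiagram.component D' a' →
          IsConj (LinkDiagram.componentProduct D f h C.1 a)
            (LinkDiagram.componentProduct D' f h (Φ C).1 a') := 
  invariantUnder_of_reidemeisterMove hS hfh hT W D D' g g'
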